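/- Let $d\ge 0$ be an integer and let $K\subset\mathbb R^d$ be a convex body (a non-empty compact convex set) with $\mathrm{Vol}(K)=1$. For $n\in\mathbb N$ let $K_n$ be the convex hull of $n$ points chosen independently and uniformly at random from $K$, and let $\mu(n)=\mathbf E\,\mathrm{Vol}(K_n)$. For $\varepsilon>0$, an $\varepsilon$-cap of $K$ is a set $H\cap K$ with $H$ a closed half-space and $\mathrm{Vol}(H\cap K)=\varepsilon$; the $\varepsilon$-wet part $\overline F_\varepsilon$ is the union of all $\varepsilon$-caps; the $\varepsilon$-floating body is $F_\varepsilon=K\setminus\overline F_\varepsilon$; and $\rho(\varepsilon)=\mathrm{Vol}(\overline F_\varepsilon)$. For $x\in\overline F_\varepsilon$ let $S_{x,\varepsilon}$ be the set of all $y\in\overline F_\varepsilon$ such that the segment $xy$ does not meet $F_\varepsilon$, and let $g(\varepsilon)=\sup_{x\in\overline F_\varepsilon}\mathrm{Vol}(S_{x,\varepsilon})$ (with $\sup\emptyset=0$). For $\nu>0$ and $n\ge 1$ put $\varepsilon^*=\nu\,\frac{\log n}{n}$. 1. There are constants $\nu_0>0$ and $C$, depending only on $K$, such that for every $\nu\ge\nu_0$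 there is an $N$ such that for all integers $n\ge N$ and $m\ge 0$ $$|\mu(n+m)-\mu(n)|\le C\big(g(\varepsilon^*)\,m\,\rho(\varepsilon^*)+g(\varepsilon^*)\log n\big).$$ 2. Suppose that $K$ is smooth, that is, its boundary is twice differentiable (locally the graph of a twice differentiable function over a hyperplane) with all principal curvatures bounded between two positive constants. Then there are constants $C$, $A$, $N$, depending only on $K$, such that for all integers $n\ge N$ and $m\ge 0$ $$|\mu(n+m)-\mu(n)|\le C\,\big(m\,n^{-2/(d+1)}+1\big)\,n^{-1}(\log n)^{A}.$$ 3. Suppose that $K$ is a polytope (the convex hull of finitely many points). Then there are constants $C$, $A$, $N$, depending only on $K$, such that for all integers $n\ge N$ and $m\ge 0$ $$|\mu(n+m)-\mu(n)|\le C\,\Big(\frac mn+1\Big)\,n^{-1}(\log n)^{A}.$$ -/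

import Mathlib

open MeasureTheory

/-- The expected volume `μ(n)` of the random polytope `K_n`, the convex hull of `n` points chosen
independently and uniformly from `K`. -/
noncomputable def expectedHullVolume {d : ℕ} (K : Set (EuclideanSpace ℝ (Fin d))) (n : ℕ) : ℝ :=
  ∫ x : Fin n → EuclideanSpace ℝ (Fin d), volume.real (convexHull ℝ (Set.range x))
    ∂(Measure.pi fun _ : Fin n => ProbabilityTheory.cond volume K)

/-- `H` is a closed half-space of `ℝ^d`. -/
def IsHalfSpace {d : ℕ} (H : Set (EuclideanSpace ℝ (Fin d))) : Prop :=
  ∃ (a : EuclideanSpace ℝ (Fin d)) (b : ℝ), a ≠ 0 ∧ H = {x | b ≤ inner ℝ a x}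

/-- `C` is an `ε`-cap of `K`: the intersection of `K` with a half-space, of volume `ε`. -/
def IsCap {d : ℕ} (K : Set (EuclideanSpace ℝ (Fin d))) (ε : ℝ)
    (C : Set (EuclideanSpace ℝ (Fin d))) : Prop :=
  (∃ H, IsHalfSpace H ∧ C = H ∩ K) ∧ volume.real C = ε

/-- The `ε`-wet part of `K`: the union of all `ε`-caps. -/
def wetPart {d : ℕ} (K : Set (EuclideanSpace ℝ (Fin d))) (ε : ℝ) :
    Set (EuclideanSpace ℝ (Fin d)) :=
  ⋃₀ {C | IsCap K ε C}

/-- The `ε`-floating body of `K`: the complement in `K` of the `ε`-wet part. -/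
def floatingBody {d : ℕ} (K : Set (EuclideanSpace ℝ (Fin d))) (ε : ℝ) :
    Set (EuclideanSpace ℝ (Fin d)) :=
  K \ wetPart K ε

/-- The volume `ρ(ε)` of the `ε`-wet part of `K`. -/
noncomputable def wetVolume {d : ℕ} (K : Set (EuclideanSpace ℝ (Fin d))) (ε : ℝ) : ℝ :=
  volume.real (wetPart K ε)

/-- The set `S_{x, ε}` of the points `y` of the `ε`-wet part that `x` sees: the segment from `x` to
`y` does not meet the `ε`-floating body. -/
def seenFrom {d : ℕ} (K : Set (EuclideanSpace ℝ (Fin d))) (ε : ℝ)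
    (x : EuclideanSpace ℝ (Fin d)) : Set (EuclideanSpace ℝ (Fin d)) :=
  {y ∈ wetPart K ε | Disjoint (segment ℝ x y) (floatingBody K ε)}

/-- `g(ε)`, the supremum of `Vol (S_{x, ε})` over the points `x` of the `ε`-wet part. -/
noncomputable def maxSeenVolume {d : ℕ} (K : Set (EuclideanSpace ℝ (Fin d))) (ε : ℝ) : ℝ :=
  ⨆ x : wetPart K ε, volume.real (seenFrom K ε x)

/-- `K` is smooth: its boundary is twice differentiable, with all principal curvatures between two
positive constants. Near each boundary point `K` is the region above the graph of a twice
differentiable function `h` on a hyperplane `u^⊥`, for a unit vector `u`. The tangent vector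
`w + (h' w) u` of the graph has first fundamental form `|w|^2 + (h' w)^2` and second fundamental form
`h''(w, w) / √(1 + |h'|^2)`; the normal curvature is the quotient of the second by the first. -/
def IsSmoothBody {d : ℕ} (K : Set (EuclideanSpace ℝ (Fin d))) : Prop :=
  ∃ κ₁ κ₂ : ℝ, 0 < κ₁ ∧ ∀ p ∈ frontier K,
    ∃ (u : EuclideanSpace ℝ (Fin d)) (U : Set (EuclideanSpace ℝ (Fin d)))
      (h : (ℝ ∙ u)ᗮ → ℝ),
      ‖u‖ = 1 ∧ IsOpen U ∧ p ∈ U ∧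
      (∀ q ∈ U, DifferentiableAt ℝ h ((ℝ ∙ u)ᗮ.orthogonalProjectionOnto q) ∧
        DifferentiableAt ℝ (fderiv ℝ h) ((ℝ ∙ u)ᗮ.orthogonalProjectionOnto q)) ∧
      (∀ q ∈ U, q ∈ K ↔ h ((ℝ ∙ u)ᗮ.orthogonalProjectionOnto q) ≤ inner ℝ u q) ∧
      ∀ q ∈ U ∩ frontier K, ∀ y : (ℝ ∙ u)ᗮ, y = (ℝ ∙ u)ᗮ.orthogonalProjectionOnto q →
        ∀ w : (ℝ ∙ u)ᗮ,
          κ₁ * (‖w‖ ^ 2 + fderiv ℝ h y w ^ 2)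
              ≤ fderiv ℝ (fderiv ℝ h) y w w / √(1 + ‖fderiv ℝ h y‖ ^ 2) ∧
          fderiv ℝ (fderiv ℝ h) y w w / √(1 + ‖fderiv ℝ h y‖ ^ 2)
              ≤ κ₂ * (‖w‖ ^ 2 + fderiv ℝ h y w ^ 2)

/-- `K` is a polytope: the convex hull of finitely many points. -/
def IsConvexPolytope {d : ℕ} (K : Set (EuclideanSpace ℝ (Fin d))) : Prop :=
  ∃ V : Set (EuclideanSpace ℝ (Fin d)), V.Finite ∧ K = convexHull ℝ V

/-!
Write `Q_n(y)` for the probability that `n` uniform random points of `K` have a convex hull that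
misses `y` (`missProb`), so that `μ(n) = 1 - ∫_K Q_n` (`expectedHullVolume_eq`). The increment
`μ(n + 1) - μ(n)` is the integral over `y` of the probability that the new point captures `y`
(`pivotMean`), and everything rests on two bounds for it and one bound for `Q_n`.

*Deep points.* If every half-space at `y` cuts off volume at least `ε` from `K`, then
`Q_n(y) ≤ C ε⁻ᵈ (1 - ε / 2)ⁿ` (`exists_missProb_le_of_isDeep`). A half-space that separates `y` from
the random points may be moved to one of `O(ε⁻ᵈ)` fixed half-spaces, at the cost of half its volume,
since slabs of width `t` meet `K` in volume `O(t)`. For `ε = ν log n / n` with `ν` large this is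
smaller than any given power of `1 / n`.

*Increments and the floating body.* Suppose that the new point `z` captures `y` although `z` does
not see `y`. Then the segment from `z` to `y` contains a point `w` of the floating body, and `w` was
missed by the first `n` points: otherwise `y`, which lies between `w` and a point of their hull,
would have been captured before. As `w` is deep, this is very unlikely. If `z` sees `y`, then `z`
lies in the wet part and `y` in a set of volume at most `g(ε)`. So the increment is at most
`ρ(ε) g(ε)` up to a negligible error (`pivotMean_le_of_floatingBody`), for all sample sizes from `n`
on, and the errors sum up to less than `g(ε)`, because `g(ε) ≥ ε`.

*Increments and the missed volume.* For smooth bodies and polytopes no estimate of `g` is needed. By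
Carathéodory's theorem at most `d + 1` of `n + 1` points are indispensable for having `y` in the
hull, and none is if `y` lies in the hull of each of two halves of the sample. By exchangeability a
given point is indispensable with probability at most `2 (d + 1) Q_{⌊(n + 1) / 2⌋}(y) / (n + 1)`
(`pivotProb_le`). Hence the increments are `O(1 / n)` times the missed volume `∫_K Q_{⌊(n + 1) / 2⌋}`,
and that is at most the volume of the points of depth less than `ε = 4 (d + 1) log n / n`, up to
`O(1 / n)`.

*Polytopes.* A polytope is covered by corners of simplices spanned by its vertices. In affine
coordinates `v ≥ 0` at the corner a half-space at `v` contains one of the orthants at `v`, so that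
the depth is at least `c ∏ vᵢ`; and `∏ vᵢ ≤ t` holds on a subset of the unit cube of volume at most
`t ^ (1 - δ) δ⁻ᵈ`, which with `δ = 1 / log n` gives `O(log ^ (d + 1) n / n)`.

*Smooth bodies.* By the bound on the curvatures and compactness a ball of some radius `r` rolls freely
inside `K`, so that `K` is a union of balls of radius `r`. A point of the copy of `K` shrunk by
`1 - s` lies at height at least `r s` in such a ball, hence has depth at least
`c s ^ ((d + 1) / 2)`, and the remaining volume is at most `d s`. This gives
`O((log n / n) ^ (2 / (d + 1)))`.
-/

/-! ### Random points and their convex hull -/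

section RandomHull

open Set ProbabilityTheory
open scoped ENNReal

/-- Selecting distinct coordinates of an i.i.d. family gives an i.i.d. family. -/
lemma measurePreserving_comp_injective {α : Type*} [MeasurableSpace α] (P : Measure α)
    [IsProbabilityMeasure P]
    {ι κ : Type*} [Fintype ι] [Fintype κ] {e : κ → ι} (he : Function.Injective e) :
    MeasurePreserving (fun x : ι → α => x ∘ e) (Measure.pi fun _ => P) (Measure.pi fun _ => P) := by
  refine ⟨by fun_prop, ?_⟩
  have h : iIndepFun (fun (i : ι) (x : ι → α) => x i) (Measure.pi fun _ : ι => P) :=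
    iIndepFun_pi (X := fun _ => id) fun _ => aemeasurable_id
  have h2 := (iIndepFun_iff_map_fun_eq_pi_map (fun i => (measurable_pi_apply _).aemeasurable)).1
    (h.precomp he)
  change Measure.map (fun (x : ι → α) (i : κ) => x (e i)) _ = _
  rw [h2]
  congr 1
  funext i
  exact (measurePreserving_eval (fun _ : ι => P) (e i)).map_eq

variable {E : Type*} [NormedAddCommGroup E] [NormedSpace ℝ E]

lemma convexHull_range_eq_image_stdSimplex {ι : Type*} [Fintype ι] (x : ι → E) :
    convexHull ℝ (range x) = (fun w : ι → ℝ => ∑ i, w i • x i) '' stdSimplex ℝ ι := by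
  classical
  have h := (Fintype.linearCombination ℝ x).image_convexHull
    (range fun i => Pi.single i (1 : ℝ))
  rw [convexHull_rangle_single_eq_stdSimplex] at h
  have h2 : (Fintype.linearCombination ℝ x) '' (range fun i => Pi.single i (1 : ℝ))
      = range x := by
    rw [← range_comp]
    congr 1
    ext i
    simp [Fintype.linearCombination_apply]
  rw [h2] at h
  rw [← h]
  rfl

/-- The incidence relation "`y` lies in the convex hull of the points `x i`" is closed: it is a
projection along the compact standard simplex. -/
lemma isClosed_setOf_mem_convexHull_range {ι : Type*} [Fintype ι] :
    IsClosed {p : (ι → E) × E | p.2 ∈ convexHull ℝ (range p.1)} := by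
  have h : {p : (ι → E) × E | p.2 ∈ convexHull ℝ (range p.1)} =
      Prod.snd '' {q : stdSimplex ℝ ι × ((ι → E) × E) | ∑ i, q.1.1 i • q.2.1 i = q.2.2} := by
    ext p
    simp only [mem_ofPred_eq, convexHull_range_eq_image_stdSimplex, mem_image, Prod.exists,
      exists_eq_right, Subtype.exists, exists_prop]
  rw [h]
  refine isClosedMap_snd_of_compactSpace _ (isClosed_eq ?_ (by fun_prop))
  refine continuous_finsetSum _ fun i _ => Continuous.smul ?_ (by fun_prop)
  exact (continuous_apply i).comp (continuous_subtype_val.comp continuous_fst)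

lemma image_compl_singleton_eq_range_succAbove {α : Type*} {n : ℕ} (x : Fin (n + 1) → α)
    (i : Fin (n + 1)) :
    x '' {i}ᶜ = range (x ∘ i.succAbove) := by
  rw [range_comp, Fin.range_succAbove]

variable [FiniteDimensional ℝ E]

open Classical in
/-- By Carathéodory's theorem at most `dim E + 1` of the points are indispensable for having a
given point in the convex hull. -/
lemma card_pivots_le {n : ℕ} (x : Fin (n + 1) → E) (y : E) :
    (Finset.univ.filter fun i =>
      y ∈ convexHull ℝ (range x) ∧ y ∉ convexHull ℝ (x '' {i}ᶜ)).card
        ≤ Module.finrank ℝ E + 1 := by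
  by_cases hy : y ∈ convexHull ℝ (range x)
  swap
  · simp [hy]
  rw [convexHull_eq_union] at hy
  simp only [mem_iUnion] at hy
  obtain ⟨t, ht, hind, hyt⟩ := hy
  have hcard : t.card ≤ Module.finrank ℝ E + 1 := by
    have := hind.card_le_finrank_succ
    rw [Fintype.card_coe] at this
    exact this.trans (Nat.add_le_add_right (Submodule.finrank_le _) 1)
  choose! j hj using fun v (hv : v ∈ (t : Set E)) => ht hv
  refine le_trans (le_trans (Finset.card_le_card ?_) (Finset.card_image_le (s := t) (f := j))) hcard
  intro i hi
  by_contra hij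
  refine (Finset.mem_filter.1 hi).2.2 (convexHull_mono ?_ hyt)
  intro v hv
  refine ⟨j v, fun h => hij ?_, hj v hv⟩
  rw [← mem_singleton_iff.1 h]
  exact Finset.mem_image_of_mem j hv

variable [MeasurableSpace E] [BorelSpace E]

lemma measurableSet_setOf_mem_convexHull_range {ι α : Type*} [Fintype ι] [MeasurableSpace α]
    {f : α → ι → E} {g : α → E} (hf : Measurable f) (hg : Measurable g) :
    MeasurableSet {a | g a ∈ convexHull ℝ (range (f a))} :=
  isClosed_setOf_mem_convexHull_range.measurableSet.preimage (hf.prodMk hg)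

/-- The probability that the convex hull of `n` independent points with law `P` misses `y`. -/
noncomputable def missProb (P : Measure E) (n : ℕ) (y : E) : ℝ≥0∞ :=
  Measure.pi (fun _ : Fin n => P) {x | y ∉ convexHull ℝ (range x)}

/-- The probability that `y` lies in the convex hull of `n + 1` independent points with law `P`
but not in that of the points other than the `i`-th. -/
noncomputable def pivotProb (P : Measure E) (n : ℕ) (i : Fin (n + 1)) (y : E) : ℝ≥0∞ :=
  Measure.pi (fun _ : Fin (n + 1) => P)
    {x | y ∈ convexHull ℝ (range x) ∧ y ∉ convexHull ℝ (x '' {i}ᶜ)}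

variable (P : Measure E) [IsProbabilityMeasure P]

lemma measurable_missProb (n : ℕ) : Measurable (missProb P n) :=
  measurable_measure_prodMk_left (ν := Measure.pi (fun _ : Fin n => P))
    (s := {p : E × (Fin n → E) | p.1 ∉ convexHull ℝ (range p.2)})
    (measurableSet_setOf_mem_convexHull_range measurable_snd measurable_fst).compl

/-- The hull of any `h` of the `n` points misses `y` with the same probability. -/
lemma measure_notMem_convexHull_comp {n h : ℕ} {e : Fin h → Fin n} (he : Function.Injective e)
    (y : E) : Measure.pi (fun _ : Fin n => P) {x | y ∉ convexHull ℝ (range (x ∘ e))} =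
      missProb P h y :=
  (measurePreserving_comp_injective P he).measure_preimage
    (measurableSet_setOf_mem_convexHull_range measurable_id
      measurable_const).compl.nullMeasurableSet

lemma missProb_anti {h n : ℕ} (hn : h ≤ n) (y : E) : missProb P n y ≤ missProb P h y := by
  rw [← measure_notMem_convexHull_comp P (Fin.castLE_injective hn)]
  exact measure_mono fun x hx hy => hx (convexHull_mono (range_comp_subset_range _ _) hy)

lemma measurableSet_pivot (n : ℕ) (i : Fin (n + 1)) (y : E) :
    MeasurableSet {x : Fin (n + 1) → E |
      y ∈ convexHull ℝ (range x) ∧ y ∉ convexHull ℝ (x '' {i}ᶜ)} := by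
  simp only [image_compl_singleton_eq_range_succAbove]
  exact (measurableSet_setOf_mem_convexHull_range measurable_id measurable_const).inter
    (measurableSet_setOf_mem_convexHull_range (f := fun x : Fin (n + 1) → E => x ∘ i.succAbove)
      (by fun_prop) measurable_const).compl

lemma missProb_le_missProb_succ_add_pivotProb (n : ℕ) (i : Fin (n + 1)) (y : E) :
    missProb P n y ≤ missProb P (n + 1) y + pivotProb P n i y := by
  rw [← measure_notMem_convexHull_comp P i.succAbove_right_injective]
  refine (measure_mono fun x hx => ?_).trans (measure_union_le _ _)
  by_cases h : y ∈ convexHull ℝ (range x)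
  · refine Or.inr ⟨h, ?_⟩
    rw [image_compl_singleton_eq_range_succAbove]
    exact hx
  · exact Or.inl h

lemma pivotProb_eq (n : ℕ) (i j : Fin (n + 1)) (y : E) : pivotProb P n i y = pivotProb P n j y := by
  have h := (measurePreserving_comp_injective P (Equiv.swap i j).injective).measure_preimage
    (measurableSet_pivot n i y).nullMeasurableSet
  rw [pivotProb, ← h, pivotProb]
  congr 1
  ext x
  have h1 : range (x ∘ Equiv.swap i j) = range x := (Equiv.swap i j).surjective.range_comp x
  have h2 : (x ∘ Equiv.swap i j) '' {i}ᶜ = x '' {j}ᶜ := by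
    rw [image_comp, image_compl_eq (Equiv.swap i j).bijective, image_singleton,
      Equiv.swap_apply_left]
  simp only [mem_preimage, mem_ofPred_eq, h1, h2]

/-- A point that lies in the hull of both halves of the sample needs no single one of the points;
so, by exchangeability and Carathéodory's theorem, a given point of the sample is indispensable for
`y` with probability `O(1 / n)` times the probability that half the sample misses `y`. -/
lemma pivotProb_le (n : ℕ) (i : Fin (n + 1)) (y : E) :
    (n + 1) * pivotProb P n i y
      ≤ (Module.finrank ℝ E + 1) * (2 * missProb P ((n + 1) / 2) y) := by
  classical
  set h := (n + 1) / 2 with hh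
  have hle : h + h ≤ n + 1 := by omega
  let e₁ : Fin h → Fin (n + 1) := fun k => ⟨k, by omega⟩
  let e₂ : Fin h → Fin (n + 1) := fun k => ⟨h + k, by omega⟩
  have he₁ : Function.Injective e₁ := fun a b hab => by
    simp only [e₁, Fin.mk.injEq] at hab; exact Fin.ext hab
  have he₂ : Function.Injective e₂ := fun a b hab => by
    simp only [e₂, Fin.mk.injEq] at hab; exact Fin.ext (by omega)
  let B : Set (Fin (n + 1) → E) := {x | y ∉ convexHull ℝ (range (x ∘ e₁))} ∪
    {x | y ∉ convexHull ℝ (range (x ∘ e₂))}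
  let A : Fin (n + 1) → Set (Fin (n + 1) → E) := fun j =>
    {x | y ∈ convexHull ℝ (range x) ∧ y ∉ convexHull ℝ (x '' {j}ᶜ)}
  have hAB : ∀ j, A j ⊆ B := by
    intro j x hx
    by_contra hB
    simp only [B, mem_union, mem_ofPred_eq, not_or, not_not] at hB
    by_cases hj : (j : ℕ) < h
    · refine hx.2 (convexHull_mono ?_ hB.2)
      rintro _ ⟨k, rfl⟩
      refine ⟨e₂ k, fun hk => ?_, rfl⟩
      have := congrArg Fin.val (mem_singleton_iff.1 hk)
      simp only [e₂] at this
      omega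
    · refine hx.2 (convexHull_mono ?_ hB.1)
      rintro _ ⟨k, rfl⟩
      refine ⟨e₁ k, fun hk => ?_, rfl⟩
      have := congrArg Fin.val (mem_singleton_iff.1 hk)
      simp only [e₁] at this
      omega
  have hB : MeasurableSet B :=
    (measurableSet_setOf_mem_convexHull_range (by fun_prop) measurable_const).compl.union
      (measurableSet_setOf_mem_convexHull_range (by fun_prop) measurable_const).compl
  have hA : ∀ j, MeasurableSet (A j) := fun j => measurableSet_pivot n j y
  calc (n + 1 : ℝ≥0∞) * pivotProb P n i y
      = ∑ j : Fin (n + 1), pivotProb P n j y := by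
        rw [Finset.sum_congr rfl fun j _ => pivotProb_eq P n j i y]
        simp
    _ = ∫⁻ x, ∑ j, (A j).indicator (fun _ => (1 : ℝ≥0∞)) x ∂Measure.pi fun _ => P := by
        rw [lintegral_finsetSum _ fun j _ => measurable_const.indicator (hA j)]
        refine Finset.sum_congr rfl fun j _ => ?_
        rw [lintegral_indicator (hA j)]
        simp [pivotProb, A]
    _ ≤ ∫⁻ x, B.indicator (fun _ => (Module.finrank ℝ E + 1 : ℝ≥0∞)) x ∂Measure.pi fun _ => P := by
        refine lintegral_mono fun x => ?_
        by_cases hx : x ∈ B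
        · have := card_pivots_le x y
          simp only [indicator_of_mem hx, indicator_apply, Finset.sum_boole, A, mem_ofPred_eq]
          exact_mod_cast this
        · simp only [indicator_of_notMem hx]
          rw [Finset.sum_eq_zero]
          intro j _
          exact indicator_of_notMem (fun hj => hx (hAB j hj)) _
    _ = (Module.finrank ℝ E + 1) * Measure.pi (fun _ => P) B := by
        rw [lintegral_indicator hB]
        simp
    _ ≤ _ := by
        gcongr
        refine (measure_union_le _ _).trans ?_
        rw [measure_notMem_convexHull_comp P he₁, measure_notMem_convexHull_comp P he₂, two_mul]

/-- The probability that an additional point captures `y`, by conditioning on that point. -/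
lemma pivotProb_zero_eq_lintegral (n : ℕ) (y : E) :
    pivotProb P n 0 y = ∫⁻ z, Measure.pi (fun _ : Fin n => P)
      {x | y ∈ convexHull ℝ (insert z (range x)) ∧ y ∉ convexHull ℝ (range x)} ∂P := by
  have hmp := measurePreserving_piFinSuccAbove (fun _ : Fin (n + 1) => P) 0
  have hS : MeasurableSet {p : E × (Fin n → E) |
      y ∈ convexHull ℝ (insert p.1 (range p.2)) ∧ y ∉ convexHull ℝ (range p.2)} := by
    simp only [← Fin.range_cons]
    refine (measurableSet_setOf_mem_convexHull_range ?_ measurable_const).inter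
      (measurableSet_setOf_mem_convexHull_range measurable_snd measurable_const).compl
    refine measurable_pi_lambda _ fun i => ?_
    refine Fin.cases ?_ (fun j => ?_) i
    · simpa using measurable_fst
    · simp only [Fin.cons_succ]; fun_prop
  change _ = ∫⁻ z, Measure.pi (fun _ : Fin n => P) (Prod.mk z ⁻¹' {p : E × (Fin n → E) |
    y ∈ convexHull ℝ (insert p.1 (range p.2)) ∧ y ∉ convexHull ℝ (range p.2)}) ∂P
  rw [pivotProb, ← Measure.prod_apply hS, ← hmp.measure_preimage hS.nullMeasurableSet]
  congr 1
  ext x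
  have h1 : insert (x 0) (range fun j : Fin n => x j.succ) = range x := by
    have := Fin.range_cons (x 0) (fun j : Fin n => x j.succ)
    rw [← this]
    congr 1
    exact Fin.cons_self_tail x
  have h2 : x '' {0}ᶜ = range fun j : Fin n => x j.succ := by
    rw [image_compl_singleton_eq_range_succAbove]; rfl
  rw [mem_ofPred_eq, h2, ← h1]
  rfl

end RandomHull

/-! ### Points of large half-space depth -/

section Depth

open Set
open scoped ENNReal

variable {d : ℕ}

/-- Slabs of width `t` meet a bounded set in volume `O(t)`: about `1 / t` disjoint translates of the
intersection fit into a fixed ball. -/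
lemma exists_volume_slab_le {K : Set (EuclideanSpace ℝ (Fin d))} (hK : IsCompact K) :
    ∃ C : ℝ, 0 < C ∧ ∀ (a : EuclideanSpace ℝ (Fin d)) (i : Fin d), |a i| = 1 →
      ∀ c t : ℝ, 0 < t →
        volume.real (K ∩ {z | c ≤ inner ℝ a z ∧ inner ℝ a z ≤ c + t}) ≤ C * t := by
  obtain ⟨R, hR⟩ := hK.isBounded.subset_closedBall (0 : EuclideanSpace ℝ (Fin d))
  set V := volume.real (Metric.closedBall (0 : EuclideanSpace ℝ (Fin d)) (R + 1)) with hV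
  have hV0 : 0 ≤ V := measureReal_nonneg
  refine ⟨4 * V + 2, by positivity, fun a i hai c t ht => ?_⟩
  set S := K ∩ {z | c ≤ inner ℝ a z ∧ inner ℝ a z ≤ c + t} with hS
  have hSm : MeasurableSet S := by
    have hc : Continuous fun z : EuclideanSpace ℝ (Fin d) => inner ℝ a z := by fun_prop
    exact hK.measurableSet.inter
      ((isClosed_le continuous_const hc).inter (isClosed_le hc continuous_const)).measurableSet
  set m := ⌊1 / (2 * t)⌋₊ with hm
  have hmt : 2 * t * m ≤ 1 := by
    have := Nat.floor_le (show 0 ≤ 1 / (2 * t) by positivity)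
    rw [le_div_iff₀ (by positivity)] at this
    linarith
  set g : ℕ → EuclideanSpace ℝ (Fin d) := fun k => EuclideanSpace.single i (-(2 * t * k)) with hg
  have hin : ∀ k z, inner ℝ a (z + g k) = inner ℝ a z - 2 * t * k * a i := by
    intro k z
    simp only [hg, inner_add_right, EuclideanSpace.inner_single_right]
    simp; ring
  have hdisj : Set.PairwiseDisjoint (Finset.range m : Set ℕ) fun k => (fun z => z + g k) ⁻¹' S := by
    intro k _ l _ hkl
    rw [Function.onFun, Set.disjoint_left]
    intro z hz hz'
    obtain ⟨-, h1, h2⟩ := hz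
    obtain ⟨-, h3, h4⟩ := hz'
    rw [hin] at h1 h2 h3 h4
    have hkl' : (1 : ℝ) ≤ |(k : ℝ) - l| := by
      have : (1 : ℤ) ≤ |(k : ℤ) - l| := Int.one_le_abs (by omega)
      exact_mod_cast this
    have : |2 * t * (k - l) * a i| ≤ t := by rw [abs_le]; constructor <;> linarith
    rw [abs_mul, hai, abs_mul, abs_of_pos (by positivity : 0 < 2 * t)] at this
    nlinarith
  have hsub : (⋃ k ∈ Finset.range m, (fun z => z + g k) ⁻¹' S) ⊆
      Metric.closedBall (0 : EuclideanSpace ℝ (Fin d)) (R + 1) := by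
    intro z hz
    simp only [mem_iUnion, Finset.mem_range, exists_prop] at hz
    obtain ⟨k, hk, hz⟩ := hz
    have h1 := hR hz.1
    rw [mem_closedBall_zero_iff] at h1 ⊢
    have h2 : ‖g k‖ ≤ 1 := by
      simp only [hg, PiLp.norm_single, norm_neg, Real.norm_eq_abs]
      rw [abs_of_nonneg (by positivity)]
      have : (k : ℝ) ≤ m := by exact_mod_cast hk.le
      nlinarith
    calc ‖z‖ = ‖(z + g k) - g k‖ := by simp
      _ ≤ ‖z + g k‖ + ‖g k‖ := norm_sub_le _ _
      _ ≤ R + 1 := add_le_add h1 h2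
  have hmV : m * volume.real S ≤ V := by
    have h1 := measureReal_mono (μ := volume) hsub Metric.isBounded_closedBall.measure_lt_top.ne
    have hfin : volume S ≠ ∞ := ((measure_mono inter_subset_left).trans_lt hK.measure_lt_top).ne
    rw [measureReal_biUnion_finset hdisj (fun k _ => hSm.preimage (by fun_prop))
      (fun k _ => by rw [measure_preimage_add_right]; exact hfin)] at h1
    simpa [measureReal_def, measure_preimage_add_right, hV] using h1
  have hS1 : volume.real S ≤ V := by
    refine measureReal_mono ?_ Metric.isBounded_closedBall.measure_lt_top.ne
    exact inter_subset_left.trans (hR.trans (Metric.closedBall_subset_closedBall (by linarith)))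
  rcases le_or_gt t (1 / 4) with h | h
  · have hm' : 1 / (4 * t) ≤ m := by
      have h1 := Nat.lt_floor_add_one (1 / (2 * t))
      have h2 : 1 / (2 * t) = 2 * (1 / (4 * t)) := by field_simp; norm_num
      have h3 : 1 ≤ 1 / (4 * t) := by rw [le_div_iff₀ (by positivity)]; linarith
      rw [← hm] at h1
      linarith
    have h2 : 1 / (4 * t) * volume.real S ≤ V :=
      (mul_le_mul_of_nonneg_right hm' measureReal_nonneg).trans hmV
    rw [div_mul_eq_mul_div, one_mul, div_le_iff₀ (by positivity)] at h2
    nlinarith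
  · nlinarith

/-- Every closed half-space whose bounding hyperplane passes through `y` cuts off from `K` a set of
volume at least `ε`; in other words, `y` has half-space depth at least `ε`. -/
def IsDeep (K : Set (EuclideanSpace ℝ (Fin d))) (ε : ℝ) (y : EuclideanSpace ℝ (Fin d)) : Prop :=
  ∀ a : EuclideanSpace ℝ (Fin d), a ≠ 0 → ε ≤ volume.real (K ∩ {z | inner ℝ a y ≤ inner ℝ a z})

/-- A point outside the hull is strictly separated from it by a direction that is normalised in the
supremum norm, so that some coordinate of it has absolute value one. -/
lemma exists_normalised_functional {y : EuclideanSpace ℝ (Fin d)}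
    {n : ℕ} (hn : 0 < n) {x : Fin n → EuclideanSpace ℝ (Fin d)} (hy : y ∉ convexHull ℝ (range x)) :
    ∃ (a : EuclideanSpace ℝ (Fin d)) (i : Fin d), |a i| = 1 ∧ (∀ j, |a j| ≤ 1) ∧
      ∀ k, inner ℝ a (x k) < inner ℝ a y := by
  obtain ⟨f, u, hfy, hfx⟩ := geometric_hahn_banach_closed_point (convex_convexHull ℝ (range x))
    ((finite_range x).isClosed_convexHull ℝ) hy
  set a := (InnerProductSpace.toDual ℝ (EuclideanSpace ℝ (Fin d))).symm f with ha
  have hf : ∀ z, f z = inner ℝ a z := fun z => by simp [ha]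
  have hlt : ∀ k, inner ℝ a (x k) < inner ℝ a y := fun k => by
    rw [← hf, ← hf]
    exact (hfy _ (subset_convexHull ℝ (range x) (mem_range_self k))).trans hfx
  have ha0 : a ≠ 0 := by
    intro h
    simpa [h] using hlt ⟨0, hn⟩
  obtain ⟨j₀, hj₀⟩ : ∃ j, a j ≠ 0 := by
    by_contra! h
    exact ha0 (by ext j; exact h j)
  have : Nonempty (Fin d) := ⟨j₀⟩
  obtain ⟨i, hi⟩ := Finite.exists_max fun j => |a j|
  have hi0 : 0 < |a i| := (abs_pos.2 hj₀).trans_le (hi j₀)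
  refine ⟨|a i|⁻¹ • a, i, ?_, fun j => ?_, fun k => ?_⟩
  · simp only [PiLp.smul_apply, smul_eq_mul, abs_mul, abs_inv, abs_abs]
    exact inv_mul_cancel₀ hi0.ne'
  · simp only [PiLp.smul_apply, smul_eq_mul, abs_mul, abs_inv, abs_abs]
    rw [inv_mul_le_iff₀ hi0, mul_one]
    exact hi j
  · rw [real_inner_smul_left, real_inner_smul_left]
    exact mul_lt_mul_of_pos_left (hlt k) (by simpa using hi0)

/-- A point of depth `ε` is missed by the random polytope with exponentially small probability. If
it is missed, then some half-space at it contains none of the random points; moving its direction to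
a grid of mesh `≈ ε`, one of `O(ε⁻ᵈ)` fixed half-spaces of volume at least `ε / 2` contains none of
them. -/
lemma exists_missProb_le_of_isDeep {K : Set (EuclideanSpace ℝ (Fin d))} (hK : IsCompact K)
    (hvol : volume K = 1) :
    ∃ C : ℝ, 1 ≤ C ∧ ∀ ε : ℝ, 0 < ε → ε ≤ 1 → ∀ y ∈ K, IsDeep K ε y → ∀ n : ℕ,
      missProb (volume.restrict K) n y ≤ ENNReal.ofReal (C * ε⁻¹ ^ d * (1 - ε / 2) ^ n) := by
  classical
  have : IsProbabilityMeasure (volume.restrict K) := ⟨by simpa using hvol⟩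
  obtain ⟨C₀, hC₀, hslab⟩ := exists_volume_slab_le hK
  obtain ⟨R, hR⟩ := hK.isBounded.subset_closedBall (0 : EuclideanSpace ℝ (Fin d))
  set D : ℝ := 2 * |R| * d + 1 with hD
  have hD0 : 0 < D := by positivity
  have hKD : ∀ z ∈ K, ∀ y ∈ K, ∑ j, |z j - y j| ≤ D := by
    intro z hz y hy
    have h1 : ∀ j, |z j - y j| ≤ 2 * |R| := by
      intro j
      have h2 := (PiLp.norm_apply_le z j).trans (mem_closedBall_zero_iff.1 (hR hz))
      have h3 := (PiLp.norm_apply_le y j).trans (mem_closedBall_zero_iff.1 (hR hy))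
      rw [Real.norm_eq_abs] at h2 h3
      calc |z j - y j| ≤ |z j| + |y j| := abs_sub _ _
        _ ≤ 2 * |R| := by linarith [le_abs_self R]
    calc ∑ j, |z j - y j| ≤ ∑ _j : Fin d, 2 * |R| := Finset.sum_le_sum fun j _ => h1 j
      _ ≤ D := by simp [hD]; linarith
  refine ⟨(3 * (4 * C₀ * D + 1)) ^ d, one_le_pow₀ (by nlinarith [mul_pos hC₀ hD0]),
    fun ε hε hε1 y hy hdeep n => ?_⟩
  rcases Nat.eq_zero_or_pos n with rfl | hn
  · refine (prob_le_one).trans ?_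
    rw [ENNReal.one_le_ofReal, pow_zero, mul_one, ← mul_pow]
    refine one_le_pow₀ ?_
    have h1 : 1 ≤ ε⁻¹ := (one_le_inv₀ hε).2 hε1
    nlinarith [mul_pos hC₀ hD0]
  set M : ℕ := ⌈4 * C₀ * D / ε⌉₊ with hM
  have hMlow : 4 * C₀ * D / ε ≤ M := Nat.le_ceil _
  have hM0 : (0 : ℝ) < M := lt_of_lt_of_le (by positivity) hMlow
  have hMup : (M : ℝ) ≤ (4 * C₀ * D + 1) * ε⁻¹ := by
    have h1 := (Nat.ceil_lt_add_one (show 0 ≤ 4 * C₀ * D / ε by positivity)).le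
    have h2 : 1 ≤ ε⁻¹ := (one_le_inv₀ hε).2 hε1
    rw [← hM, div_eq_mul_inv] at h1
    linarith
  let net : Finset (Fin d → ℤ) := Fintype.piFinset fun _ => Finset.Icc (-(M : ℤ)) M
  let H : (Fin d → ℤ) → Set (EuclideanSpace ℝ (Fin d)) := fun k =>
    K ∩ {z | D / M ≤ ∑ j, (k j / M : ℝ) * (z j - y j)}
  have hHm : ∀ k, MeasurableSet (H k) := fun k =>
    hK.measurableSet.inter (isClosed_le continuous_const (by fun_prop)).measurableSet
  let good := net.filter fun k => ε / 2 ≤ volume.real (H k)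
  have hcover : {x : Fin n → EuclideanSpace ℝ (Fin d) | y ∉ convexHull ℝ (range x)}
      ≤ᵐ[Measure.pi fun _ => volume.restrict K]
      (⋃ k ∈ good, univ.pi fun _ : Fin n => (H k)ᶜ : Set (Fin n → EuclideanSpace ℝ (Fin d))) := by
    have hae : ∀ᵐ x ∂(Measure.pi fun _ : Fin n => volume.restrict K), ∀ i, x i ∈ K := by
      rw [ae_all_iff]
      intro i
      exact (measurePreserving_eval (fun _ : Fin n => volume.restrict K) i).quasiMeasurePreserving.ae
        (ae_restrict_mem hK.measurableSet)
    filter_upwards [hae] with x hx hxy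
    obtain ⟨a, i, hai, ha1, hlt⟩ := exists_normalised_functional hn hxy
    let k : Fin d → ℤ := fun j => ⌊M * a j⌋
    have hk : ∀ j, |a j - k j / M| ≤ 1 / M := by
      intro j
      have h1 := Int.floor_le (M * a j)
      have h2 := Int.lt_floor_add_one (M * a j)
      have h3 : a j - k j / M = (M * a j - ⌊M * a j⌋) / M := by
        simp only [k]; field_simp
      rw [h3, abs_div, abs_of_pos hM0, abs_of_nonneg (by linarith)]
      gcongr
      linarith
    have happrox : ∀ z ∈ K, |inner ℝ a z - inner ℝ a y - ∑ j, (k j / M : ℝ) * (z j - y j)|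
        ≤ D / M := by
      intro z hz
      have h1 : inner ℝ a z - inner ℝ a y - ∑ j, (k j / M : ℝ) * (z j - y j)
          = ∑ j, (a j - k j / M) * (z j - y j) := by
        rw [← inner_sub_right, PiLp.inner_apply, ← Finset.sum_sub_distrib]
        refine Finset.sum_congr rfl fun j _ => ?_
        simp; ring
      rw [h1]
      calc |∑ j, (a j - k j / M) * (z j - y j)| ≤ ∑ j, |(a j - k j / M) * (z j - y j)| :=
            Finset.abs_sum_le_sum_abs _ _
        _ ≤ ∑ j, 1 / M * |z j - y j| := by
            refine Finset.sum_le_sum fun j _ => ?_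
            rw [abs_mul]
            exact mul_le_mul_of_nonneg_right (hk j) (abs_nonneg _)
        _ ≤ D / M := by
            rw [← Finset.mul_sum, one_div_mul_eq_div]
            exact div_le_div_of_nonneg_right (hKD z hz y hy) hM0.le
    have hknet : k ∈ net := by
      rw [Fintype.mem_piFinset]
      intro j
      obtain ⟨h1, h2⟩ := abs_le.1 (ha1 j)
      rw [Finset.mem_Icc]
      constructor
      · rw [Int.le_floor]; push_cast; nlinarith
      · have : (⌊M * a j⌋ : ℝ) ≤ M := (Int.floor_le _).trans (by nlinarith)
        exact_mod_cast this
    have hkgood : ε / 2 ≤ volume.real (H k) := by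
      have ha0 : a ≠ 0 := by
        rintro rfl
        simp at hai
      have h1 := hdeep a ha0
      have h2 := hslab a i hai (inner ℝ a y) (2 * D / M) (by positivity)
      have hfin : ∀ s, volume (K ∩ s) ≠ ∞ := fun s =>
        ((measure_mono inter_subset_left).trans_lt hK.measure_lt_top).ne
      have h3 : K ∩ {z | inner ℝ a y ≤ inner ℝ a z} ⊆
          (K ∩ {z | inner ℝ a y ≤ inner ℝ a z ∧ inner ℝ a z ≤ inner ℝ a y + 2 * D / M}) ∪ H k := by
        rintro z ⟨hz, hz2⟩
        by_cases h : inner ℝ a z ≤ inner ℝ a y + 2 * D / M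
        · exact Or.inl ⟨hz, hz2, h⟩
        · refine Or.inr ⟨hz, ?_⟩
          have h4 := (abs_le.1 (happrox z hz)).2
          have h5 : 2 * D / M = D / M + D / M := by ring
          simp only [mem_ofPred_eq]
          linarith
      have h4 := (measureReal_mono h3 (measure_union_ne_top (hfin _) (hfin _))).trans
        (measureReal_union_le _ _)
      have h5 : C₀ * (2 * D / M) ≤ ε / 2 := by
        rw [div_le_iff₀ hε] at hMlow
        rw [← mul_div_assoc, div_le_iff₀ hM0]
        linarith
      linarith
    change x ∈ ⋃ k ∈ good, univ.pi fun _ : Fin n => (H k)ᶜ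
    simp only [mem_iUnion, exists_prop]
    refine ⟨k, Finset.mem_filter.2 ⟨hknet, hkgood⟩, fun l _ hl => ?_⟩
    have h1 := (abs_le.1 (happrox _ (hx l))).1
    have h2 := hlt l
    have h3 := hl.2
    simp only [mem_ofPred_eq] at h3
    linarith
  have hone : ∀ k ∈ good, Measure.pi (fun _ : Fin n => volume.restrict K)
      (univ.pi fun _ : Fin n => (H k)ᶜ) ≤ ENNReal.ofReal ((1 - ε / 2) ^ n) := by
    intro k hk
    rw [Measure.pi_pi, Finset.prod_const, Finset.card_univ, Fintype.card_fin,
      ENNReal.ofReal_pow (by linarith)]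
    gcongr
    rw [prob_compl_eq_one_sub (hHm k), Measure.restrict_apply (hHm k),
      inter_eq_self_of_subset_left inter_subset_left,
      ENNReal.ofReal_sub _ (by linarith), ENNReal.ofReal_one]
    gcongr
    refine ENNReal.ofReal_le_of_le_toReal ?_
    exact (Finset.mem_filter.1 hk).2
  have hcard : (good.card : ℝ) ≤ (3 * (4 * C₀ * D + 1)) ^ d * ε⁻¹ ^ d := by
    have h1 : good.card ≤ (2 * M + 1) ^ d := by
      refine (Finset.card_filter_le _ _).trans ?_
      rw [Fintype.card_piFinset, Finset.prod_const, Finset.card_univ, Fintype.card_fin, Int.card_Icc]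
      apply le_of_eq
      congr 1
      omega
    have hM1 : (1 : ℝ) ≤ M := by exact_mod_cast Nat.one_le_iff_ne_zero.2 (by rintro h; simp [h] at hM0)
    calc (good.card : ℝ) ≤ ((2 * M + 1 : ℕ) : ℝ) ^ d := by exact_mod_cast h1
      _ ≤ (3 * (4 * C₀ * D + 1) * ε⁻¹) ^ d := by
          gcongr
          push_cast
          linarith
      _ = _ := mul_pow _ _ _
  calc missProb (volume.restrict K) n y
      ≤ Measure.pi (fun _ : Fin n => volume.restrict K)
          (⋃ k ∈ good, univ.pi fun _ : Fin n => (H k)ᶜ) := measure_mono_ae hcover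
    _ ≤ ∑ k ∈ good, Measure.pi (fun _ : Fin n => volume.restrict K)
          (univ.pi fun _ : Fin n => (H k)ᶜ) := measure_biUnion_finset_le _ _
    _ ≤ ∑ _k ∈ good, ENNReal.ofReal ((1 - ε / 2) ^ n) := Finset.sum_le_sum hone
    _ = ENNReal.ofReal (good.card * (1 - ε / 2) ^ n) := by
        rw [Finset.sum_const, nsmul_eq_mul, ENNReal.ofReal_mul (by positivity),
          ENNReal.ofReal_natCast]
    _ ≤ _ := by
        refine ENNReal.ofReal_le_ofReal (mul_le_mul_of_nonneg_right hcard ?_)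
        exact pow_nonneg (by linarith) _

end Depth

/-! ### The expected volume and its increments -/

section Increments

open Set
open scoped ENNReal

variable {d : ℕ}

/-- The expected volume of the part of `K` that the random polytope with `n` points misses. -/
noncomputable def missMean (K : Set (EuclideanSpace ℝ (Fin d))) (n : ℕ) : ℝ≥0∞ :=
  ∫⁻ y in K, missProb (volume.restrict K) n y

/-- The expected increment of volume when a point is added to a random polytope with `n` points. -/
noncomputable def pivotMean (K : Set (EuclideanSpace ℝ (Fin d))) (n : ℕ) : ℝ≥0∞ :=
  ∫⁻ y in K, pivotProb (volume.restrict K) n 0 y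

variable {K : Set (EuclideanSpace ℝ (Fin d))}

lemma isProbabilityMeasure_restrict_of_volume_eq_one (hvol : volume K = 1) :
    IsProbabilityMeasure (volume.restrict K) := ⟨by simpa using hvol⟩

lemma missMean_le_one (hvol : volume K = 1) (n : ℕ) : missMean K n ≤ 1 := by
  have := isProbabilityMeasure_restrict_of_volume_eq_one hvol
  calc missMean K n ≤ ∫⁻ _y in K, 1 := lintegral_mono fun y => prob_le_one
    _ = 1 := by simp

lemma missMean_anti (hvol : volume K = 1) {m n : ℕ} (h : m ≤ n) :
    missMean K n ≤ missMean K m := by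
  have := isProbabilityMeasure_restrict_of_volume_eq_one hvol
  exact lintegral_mono fun y => missProb_anti _ h y

lemma ae_forall_mem (hvol : volume K = 1) (hm : MeasurableSet K) {ι : Type*} [Fintype ι] :
    ∀ᵐ x ∂(Measure.pi fun _ : ι => volume.restrict K), ∀ i, x i ∈ K := by
  have := isProbabilityMeasure_restrict_of_volume_eq_one hvol
  rw [ae_all_iff]
  intro i
  exact (measurePreserving_eval (fun _ : ι => volume.restrict K) i).quasiMeasurePreserving.ae
    (ae_restrict_mem hm)

/-- By Fubini's theorem `μ(n)` is one minus the expected missed volume. -/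
lemma expectedHullVolume_eq (hK : IsCompact K) (hconv : Convex ℝ K) (hvol : volume K = 1) (n : ℕ) :
    expectedHullVolume K n = 1 - (missMean K n).toReal := by
  have hP := isProbabilityMeasure_restrict_of_volume_eq_one hvol
  have hcond : ProbabilityTheory.cond volume K = volume.restrict K := by
    simp [ProbabilityTheory.cond, hvol]
  have hS : MeasurableSet {p : (Fin n → EuclideanSpace ℝ (Fin d)) × EuclideanSpace ℝ (Fin d) |
      p.2 ∈ convexHull ℝ (range p.1)} := isClosed_setOf_mem_convexHull_range.measurableSet
  set π := Measure.pi (fun _ : Fin n => volume.restrict K) with hπ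
  have h1 : expectedHullVolume K n =
      ∫ x, ((volume.restrict K) (convexHull ℝ (range x))).toReal ∂π := by
    rw [expectedHullVolume, hcond]
    refine integral_congr_ae ?_
    filter_upwards [ae_forall_mem hvol hK.measurableSet] with x hx
    rw [measureReal_def, Measure.restrict_apply
      ((finite_range x).isClosed_convexHull ℝ).measurableSet,
      inter_eq_self_of_subset_left (convexHull_min (range_subset_iff.2 hx) hconv)]
  have h2 : ∫⁻ x, (volume.restrict K) (convexHull ℝ (range x)) ∂π =
      π.prod (volume.restrict K) {p | p.2 ∈ convexHull ℝ (range p.1)} :=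
    (Measure.prod_apply hS).symm
  have h3 : missMean K n = π.prod (volume.restrict K) {p | p.2 ∈ convexHull ℝ (range p.1)}ᶜ :=
    (Measure.prod_apply_symm hS.compl).symm
  have hmeas : Measurable fun x : Fin n → EuclideanSpace ℝ (Fin d) =>
      (volume.restrict K) (convexHull ℝ (range x)) := measurable_measure_prodMk_left hS
  rw [h1, integral_toReal hmeas.aemeasurable
    (Filter.Eventually.of_forall fun x => measure_lt_top _ _), h2, h3,
    prob_compl_eq_one_sub hS, ENNReal.toReal_sub_of_le prob_le_one ENNReal.one_ne_top]
  simp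

lemma missMean_le_add_sum_pivotMean (hvol : volume K = 1) (n m : ℕ) :
    missMean K n ≤ missMean K (n + m) + ∑ k ∈ Finset.range m, pivotMean K (n + k) := by
  have hP := isProbabilityMeasure_restrict_of_volume_eq_one hvol
  induction m with
  | zero => simp
  | succ m ih =>
    have h : missMean K (n + m) ≤ missMean K (n + (m + 1)) + pivotMean K (n + m) := by
      rw [missMean, missMean, pivotMean, ← lintegral_add_left (measurable_missProb _ _)]
      exact lintegral_mono fun y => missProb_le_missProb_succ_add_pivotProb _ _ _ _
    rw [Finset.sum_range_succ, add_comm (∑ k ∈ Finset.range m, _), ← add_assoc]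
    exact ih.trans (by gcongr)

lemma abs_expectedHullVolume_sub_le (hK : IsCompact K) (hconv : Convex ℝ K) (hvol : volume K = 1)
    {n m : ℕ} {B : ℝ} (hB : 0 ≤ B)
    (h : ∑ k ∈ Finset.range m, pivotMean K (n + k) ≤ ENNReal.ofReal B) :
    |expectedHullVolume K (n + m) - expectedHullVolume K n| ≤ B := by
  have hfin : ∀ k, missMean K k ≠ ∞ := fun k => ne_top_of_le_ne_top ENNReal.one_ne_top
    (missMean_le_one hvol k)
  rw [expectedHullVolume_eq hK hconv hvol, expectedHullVolume_eq hK hconv hvol]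
  have h1 := ENNReal.toReal_mono (hfin n) (missMean_anti hvol (Nat.le_add_right n m))
  have h2 := ENNReal.toReal_mono (ENNReal.add_ne_top.2 ⟨hfin _, ENNReal.ofReal_ne_top⟩)
    ((missMean_le_add_sum_pivotMean hvol n m).trans (add_le_add_right h _))
  rw [ENNReal.toReal_add (hfin _) ENNReal.ofReal_ne_top, ENNReal.toReal_ofReal hB] at h2
  rw [abs_of_nonneg] <;> linarith

/-- The increment of `μ` at `k` is at most `O(1 / k)` times the volume missed by half the points. -/
lemma pivotMean_le (hvol : volume K = 1) (k : ℕ) :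
    (k + 1) * pivotMean K k ≤ (d + 1) * (2 * missMean K ((k + 1) / 2)) := by
  have hP := isProbabilityMeasure_restrict_of_volume_eq_one hvol
  have h2 : (2 : ℝ≥0∞) ≠ ∞ := by simp
  rw [pivotMean, missMean, ← lintegral_const_mul' _ _ h2,
    ← lintegral_const_mul' _ _ (by finiteness), ← lintegral_const_mul' _ _ (by finiteness)]
  refine lintegral_mono fun y => ?_
  simpa using pivotProb_le (volume.restrict K) k 0 y

/-- If the missed volume satisfies `missMean K ((n + 1) / 2) ≤ β`, then the expected volume grows by
at most `2 (d + 1) β / n` per additional point, from the `n`-th on. -/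
lemma abs_expectedHullVolume_sub_le_of_missMean_le (hK : IsCompact K) (hconv : Convex ℝ K)
    (hvol : volume K = 1) {n : ℕ} (hn : 0 < n) (m : ℕ) {β : ℝ} (hβ : 0 ≤ β)
    (h : missMean K ((n + 1) / 2) ≤ ENNReal.ofReal β) :
    |expectedHullVolume K (n + m) - expectedHullVolume K n| ≤ m * (2 * (d + 1) * β / n) := by
  have hn' : (0 : ℝ) < n := by exact_mod_cast hn
  refine abs_expectedHullVolume_sub_le hK hconv hvol (by positivity) ?_
  have hone : ∀ k, pivotMean K (n + k) ≤ ENNReal.ofReal (2 * (d + 1) * β / n) := by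
    intro k
    have h1 := pivotMean_le hvol (n + k)
    have h2 : missMean K ((n + k + 1) / 2) ≤ ENNReal.ofReal β :=
      (missMean_anti hvol (Nat.div_le_div_right (by omega))).trans h
    have h3 : (n : ℝ≥0∞) * pivotMean K (n + k) ≤ (d + 1) * (2 * ENNReal.ofReal β) := by
      refine le_trans ?_ (h1.trans (by gcongr))
      gcongr
      push_cast
      rw [add_assoc]
      exact le_self_add
    rw [ENNReal.ofReal_div_of_pos hn', ENNReal.ofReal_natCast,
      ENNReal.le_div_iff_mul_le (by left; exact_mod_cast hn.ne') (by left; simp), mul_comm]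
    refine h3.trans (le_of_eq ?_)
    rw [ENNReal.ofReal_mul (by positivity), ENNReal.ofReal_mul (by positivity),
      ENNReal.ofReal_add (by positivity) (by positivity), ENNReal.ofReal_natCast]
    simp
    ring
  calc ∑ k ∈ Finset.range m, pivotMean K (n + k)
      ≤ ∑ _k ∈ Finset.range m, ENNReal.ofReal (2 * (d + 1) * β / n) :=
        Finset.sum_le_sum fun k _ => hone k
    _ = _ := by
        rw [Finset.sum_const, Finset.card_range, nsmul_eq_mul, ENNReal.ofReal_mul (by positivity),
          ENNReal.ofReal_natCast]

/-- The missed volume is at most the volume of the points of small depth, up to the exponentially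
small probability of missing a deep point. -/
lemma exists_missMean_le (hK : IsCompact K) (hvol : volume K = 1) :
    ∃ C : ℝ, 1 ≤ C ∧ ∀ ε : ℝ, 0 < ε → ε ≤ 1 → ∀ n : ℕ,
      missMean K n ≤ volume {y ∈ K | ¬ IsDeep K ε y} +
        ENNReal.ofReal (C * ε⁻¹ ^ d * (1 - ε / 2) ^ n) := by
  have hP := isProbabilityMeasure_restrict_of_volume_eq_one hvol
  obtain ⟨C, hC, h⟩ := exists_missProb_le_of_isDeep hK hvol
  refine ⟨C, hC, fun ε hε hε1 n => ?_⟩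
  set τ := ENNReal.ofReal (C * ε⁻¹ ^ d * (1 - ε / 2) ^ n)
  set S := toMeasurable volume {y ∈ K | ¬ IsDeep K ε y} with hS
  calc missMean K n ≤ ∫⁻ y in K, (S.indicator 1 y + τ) := by
        refine setLIntegral_mono' hK.measurableSet fun y hy => ?_
        by_cases hd : IsDeep K ε y
        · exact (h ε hε hε1 y hy hd n).trans le_add_self
        · rw [indicator_of_mem (subset_toMeasurable _ _ (show y ∈ {y ∈ K | ¬ IsDeep K ε y} from ⟨hy, hd⟩))]
          exact (prob_le_one).trans le_self_add
    _ = (volume.restrict K) S + τ := by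
        rw [lintegral_add_right _ measurable_const, lintegral_indicator_one
          (measurableSet_toMeasurable _ _)]
        simp only [lintegral_const, measure_univ, mul_one, hS]
    _ ≤ _ := by
        refine add_le_add_left ?_ _
        exact (Measure.restrict_apply_le _ _).trans (measure_toMeasurable _).le

end Increments

/-! ### Increments and the floating body -/

section FloatingBody

open Set
open scoped ENNReal

variable {d : ℕ} {K : Set (EuclideanSpace ℝ (Fin d))}

lemma abs_volume_cap_sub_le (hK : IsCompact K) :
    ∃ C : ℝ, ∀ (a : EuclideanSpace ℝ (Fin d)) (i : Fin d), |a i| = 1 → ∀ b c : ℝ, b ≤ c →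
      |volume.real (K ∩ {z | b ≤ inner ℝ a z}) - volume.real (K ∩ {z | c ≤ inner ℝ a z})|
        ≤ C * |b - c| := by
  obtain ⟨C, hC, hslab⟩ := exists_volume_slab_le hK
  refine ⟨C, fun a i hai b c hbc => ?_⟩
  rcases hbc.eq_or_lt with rfl | hbc
  · simp
  have hfin : ∀ s, volume (K ∩ s) ≠ ∞ := fun s =>
    ((measure_mono inter_subset_left).trans_lt hK.measure_lt_top).ne
  have h1 := hslab a i hai b (c - b) (by linarith)
  rw [add_sub_cancel] at h1
  have h2 : K ∩ {z | c ≤ inner ℝ a z} ⊆ K ∩ {z | b ≤ inner ℝ a z} :=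
    inter_subset_inter_right _ fun z hz => hbc.le.trans hz
  have h3 : K ∩ {z | b ≤ inner ℝ a z} ⊆
      (K ∩ {z | b ≤ inner ℝ a z ∧ inner ℝ a z ≤ c}) ∪ (K ∩ {z | c ≤ inner ℝ a z}) := by
    rintro z ⟨hz, hb⟩
    rcases le_total (inner ℝ a z) c with h | h
    · exact Or.inl ⟨hz, hb, h⟩
    · exact Or.inr ⟨hz, h⟩
  have h4 := measureReal_mono h2 (hfin _)
  have h5 := (measureReal_mono h3 (measure_union_ne_top (hfin _) (hfin _))).trans
    (measureReal_union_le _ _)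
  rw [abs_of_nonneg (by linarith), abs_sub_comm, abs_of_pos (by linarith : 0 < c - b)]
  linarith

/-- Caps of prescribed volume exist in every direction, by the intermediate value theorem. -/
lemma exists_volume_cap_eq (hK : IsCompact K) (hvol : volume K = 1)
    {a : EuclideanSpace ℝ (Fin d)} {i : Fin d} (hai : |a i| = 1) {b₀ ε : ℝ} (hε : ε ≤ 1)
    (hb₀ : volume.real (K ∩ {z | b₀ ≤ inner ℝ a z}) ≤ ε) :
    ∃ b ≤ b₀, volume.real (K ∩ {z | b ≤ inner ℝ a z}) = ε := by
  obtain ⟨C, hC⟩ := abs_volume_cap_sub_le hK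
  set φ : ℝ → ℝ := fun b => volume.real (K ∩ {z | b ≤ inner ℝ a z}) with hφ
  have hcont : Continuous φ := by
    refine (LipschitzWith.of_dist_le' (K := C) fun b c => ?_).continuous
    rw [Real.dist_eq, Real.dist_eq]
    rcases le_total b c with h | h
    · exact hC a i hai b c h
    · rw [abs_sub_comm, abs_sub_comm b]
      exact hC a i hai c b h
  obtain ⟨R, hR⟩ := hK.isBounded.subset_closedBall (0 : EuclideanSpace ℝ (Fin d))
  set b₁ := min b₀ (-(‖a‖ * R)) with hb₁
  have h1 : φ b₁ = 1 := by
    have : K ∩ {z | b₁ ≤ inner ℝ a z} = K := by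
      refine inter_eq_left.2 fun z hz => ?_
      have h2 := (abs_le.1 (abs_real_inner_le_norm a z)).1
      have h3 := mem_closedBall_zero_iff.1 (hR hz)
      have h4 : ‖a‖ * ‖z‖ ≤ ‖a‖ * R := mul_le_mul_of_nonneg_left h3 (norm_nonneg _)
      have h5 : -(‖a‖ * R) ≤ inner ℝ a z := by linarith
      exact (min_le_right _ _).trans h5
    simp only [hφ, this, measureReal_def, hvol, ENNReal.toReal_one]
  obtain ⟨b, hb, hbε⟩ := intermediate_value_Icc' (min_le_left b₀ (-(‖a‖ * R))) hcont.continuousOn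
    (show ε ∈ Icc (φ b₀) (φ b₁) from ⟨hb₀, h1 ▸ hε⟩)
  exact ⟨b, hb.2, hbε⟩

lemma isCap_of_volume_eq {a : EuclideanSpace ℝ (Fin d)} (ha : a ≠ 0) {b ε : ℝ}
    (h : volume.real (K ∩ {z | b ≤ inner ℝ a z}) = ε) : IsCap K ε ({z | b ≤ inner ℝ a z} ∩ K) :=
  ⟨⟨_, ⟨a, b, ha, rfl⟩, rfl⟩, by rwa [inter_comm]⟩

lemma wetPart_subset (ε : ℝ) : wetPart K ε ⊆ K := by
  rintro x ⟨C, ⟨⟨H, -, rfl⟩, -⟩, hx⟩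
  exact hx.2

/-- The points of the floating body have depth at least `ε`: a shallower half-space at such a point
could be enlarged to one that cuts off exactly `ε`. -/
lemma isDeep_of_mem_floatingBody (hK : IsCompact K) (hvol : volume K = 1) {ε : ℝ} (hε : ε ≤ 1)
    {w : EuclideanSpace ℝ (Fin d)} (hw : w ∈ floatingBody K ε) : IsDeep K ε w := by
  intro a ha
  by_contra! hlt
  obtain ⟨i, hi⟩ : ∃ i, a i ≠ 0 := by
    by_contra! h
    exact ha (by ext j; exact h j)
  have hi0 : 0 < |a i| := abs_pos.2 hi
  set a' := |a i|⁻¹ • a with ha'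
  have hai : |a' i| = 1 := by
    simp only [ha', PiLp.smul_apply, smul_eq_mul, abs_mul, abs_inv, abs_abs]
    exact inv_mul_cancel₀ hi0.ne'
  have heq : {z | inner ℝ a' w ≤ inner ℝ a' z} = {z | inner ℝ a w ≤ inner ℝ a z} := by
    ext z
    simp only [mem_ofPred_eq, ha', real_inner_smul_left]
    exact mul_le_mul_iff_right₀ (inv_pos.2 hi0)
  rw [← heq] at hlt
  obtain ⟨b, hb, hbε⟩ := exists_volume_cap_eq hK hvol hai hε hlt.le
  have ha'0 : a' ≠ 0 := by
    intro h
    rw [h] at hai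
    simp at hai
  exact hw.2 ⟨_, isCap_of_volume_eq ha'0 hbε, hb, hw.1⟩

lemma bddAbove_seenVolume (hvol : volume K = 1) (ε : ℝ) :
    BddAbove (range fun x : wetPart K ε => volume.real (seenFrom K ε x)) := by
  refine ⟨1, ?_⟩
  rintro _ ⟨x, rfl⟩
  have h1 : volume.real (seenFrom K ε x) ≤ volume.real K :=
    measureReal_mono (fun y hy => wetPart_subset ε hy.1) (by simp [hvol])
  rwa [measureReal_def volume K, hvol, ENNReal.toReal_one] at h1

lemma maxSeenVolume_nonneg (ε : ℝ) : 0 ≤ maxSeenVolume K ε :=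
  Real.iSup_nonneg fun _ => measureReal_nonneg

/-- All points of an `ε`-cap see each other, so that `g(ε) ≥ ε`. -/
lemma le_maxSeenVolume (hd : 0 < d) (hK : IsCompact K) (hconv : Convex ℝ K) (hvol : volume K = 1)
    {ε : ℝ} (hε0 : 0 < ε) (hε : ε ≤ 1) : ε ≤ maxSeenVolume K ε := by
  set i : Fin d := ⟨0, hd⟩
  set a : EuclideanSpace ℝ (Fin d) := EuclideanSpace.single i 1 with ha
  have hai : |a i| = 1 := by simp [ha]
  have ha0 : a ≠ 0 := by
    intro h
    rw [h] at hai
    simp at hai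
  obtain ⟨R, hR⟩ := hK.isBounded.subset_closedBall (0 : EuclideanSpace ℝ (Fin d))
  have h0 : K ∩ {z | ‖a‖ * R + 1 ≤ inner ℝ a z} = ∅ := by
    refine eq_empty_of_forall_notMem fun z hz => ?_
    have h2 := (abs_le.1 (abs_real_inner_le_norm a z)).2
    have h3 := mem_closedBall_zero_iff.1 (hR hz.1)
    have h4 : ‖a‖ * ‖z‖ ≤ ‖a‖ * R := mul_le_mul_of_nonneg_left h3 (norm_nonneg _)
    have h5 := hz.2
    simp only [mem_ofPred_eq] at h5
    linarith
  obtain ⟨b, -, hb⟩ := exists_volume_cap_eq hK hvol hai (b₀ := ‖a‖ * R + 1) hε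
    (by rw [h0]; simpa using hε0.le)
  have hcap := isCap_of_volume_eq ha0 hb
  set C := {z | b ≤ inner ℝ a z} ∩ K with hC
  have hCwet : C ⊆ wetPart K ε := subset_sUnion_of_mem hcap
  have hCconv : Convex ℝ C := (convex_halfSpace_ge (innerₛₗ ℝ a).isLinear b).inter hconv
  obtain ⟨x, hx⟩ : C.Nonempty := by
    rw [nonempty_iff_ne_empty]
    intro h
    have := hcap.2
    rw [h] at this
    simp at this
    exact hε0.ne this
  have hsub : C ⊆ seenFrom K ε x := fun y hy => ⟨hCwet hy, disjoint_left.2 fun w hw hw' =>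
    hw'.2 (hCwet (hCconv.segment_subset hx hy hw))⟩
  have hfin : volume (seenFrom K ε x) ≠ ∞ := ne_top_of_le_ne_top ENNReal.one_ne_top
    (hvol ▸ measure_mono fun y hy => wetPart_subset ε hy.1)
  exact (hcap.2.symm.le.trans (measureReal_mono hsub hfin)).trans
    (le_ciSup (bddAbove_seenVolume hvol ε) ⟨x, hCwet hx⟩)

/-- If a new vertex `z` captures `y`, then every point of the segment from `z` to `y` was missed
before. -/
lemma notMem_convexHull_of_mem_segment {ι : Type*} {x : ι → EuclideanSpace ℝ (Fin d)}
    {y z w : EuclideanSpace ℝ (Fin d)} (hy : y ∈ convexHull ℝ (insert z (range x)))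
    (hy' : y ∉ convexHull ℝ (range x)) (hw : w ∈ segment ℝ z y) : w ∉ convexHull ℝ (range x) := by
  intro hwx
  rcases (range x).eq_empty_or_nonempty with h | h
  · simp [h] at hwx
  rw [convexHull_insert h, convexJoin_singleton_left] at hy
  simp only [mem_iUnion, exists_prop] at hy
  obtain ⟨v, hv, hyv⟩ := hy
  refine hy' ((convex_convexHull ℝ (range x)).segment_subset hwx hv ?_)
  rw [mem_segment_iff_wbtw] at *
  exact hyv.trans_left_right hw

/-- If every point of the floating body is missed with probability at most `τ`, then an additional
point increases the expected volume by at most `ρ(ε) g(ε) + τ`: unless a point of the floating body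
is missed, the new point `z` lies in the wet part and only captures points that it sees. -/
lemma pivotMean_le_of_floatingBody (hK : IsCompact K) (hvol : volume K = 1) (ε : ℝ) (n : ℕ)
    {τ : ℝ≥0∞} (hτ : ∀ w ∈ floatingBody K ε, missProb (volume.restrict K) n w ≤ τ) :
    pivotMean K n ≤ ENNReal.ofReal (maxSeenVolume K ε * wetVolume K ε) + τ := by
  have hP := isProbabilityMeasure_restrict_of_volume_eq_one hvol
  set π := Measure.pi (fun _ : Fin n => volume.restrict K) with hπ
  let f : EuclideanSpace ℝ (Fin d) → EuclideanSpace ℝ (Fin d) → ℝ≥0∞ := fun y z =>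
    π {x | y ∈ convexHull ℝ (insert z (range x)) ∧ y ∉ convexHull ℝ (range x)}
  have hf1 : ∀ y z, f y z ≤ 1 := fun y z => prob_le_one
  have hfτ : ∀ y z w, w ∈ segment ℝ z y → w ∈ floatingBody K ε → f y z ≤ τ := fun y z w hw hwF =>
    (measure_mono fun x hx => notMem_convexHull_of_mem_segment hx.1 hx.2 hw).trans (hτ w hwF)
  have hmeas : Measurable (Function.uncurry f) := by
    have hS : MeasurableSet {p : (EuclideanSpace ℝ (Fin d) × EuclideanSpace ℝ (Fin d)) ×
        (Fin n → EuclideanSpace ℝ (Fin d)) |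
        p.1.1 ∈ convexHull ℝ (insert p.1.2 (range p.2)) ∧ p.1.1 ∉ convexHull ℝ (range p.2)} := by
      simp only [← Fin.range_cons]
      refine (measurableSet_setOf_mem_convexHull_range ?_ (by fun_prop)).inter
        (measurableSet_setOf_mem_convexHull_range measurable_snd (by fun_prop)).compl
      refine measurable_pi_lambda _ fun i => ?_
      refine Fin.cases ?_ (fun j => ?_) i
      · simp only [Fin.cons_zero]; fun_prop
      · simp only [Fin.cons_succ]; fun_prop
    exact measurable_measure_prodMk_left hS
  set W := toMeasurable volume (wetPart K ε) with hW
  have hle : ∀ s : Set (EuclideanSpace ℝ (Fin d)),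
      (volume.restrict K) (toMeasurable volume s) ≤ volume s := fun s =>
    (Measure.restrict_apply_le _ _).trans (measure_toMeasurable _).le
  have hfin : ∀ s ⊆ wetPart K ε, volume s ≠ ∞ := fun s hs =>
    ne_top_of_le_ne_top ENNReal.one_ne_top (hvol ▸ measure_mono (hs.trans (wetPart_subset ε)))
  have hinner : ∀ z ∈ K, ∫⁻ y in K, f y z ≤
      W.indicator (fun _ => ENNReal.ofReal (maxSeenVolume K ε)) z + τ := by
    intro z hz
    by_cases hzw : z ∈ wetPart K ε
    · rw [indicator_of_mem (subset_toMeasurable _ _ hzw)]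
      set S := toMeasurable volume (seenFrom K ε z) with hS
      calc ∫⁻ y in K, f y z ≤ ∫⁻ y in K, (S.indicator 1 y + τ) := by
            refine setLIntegral_mono' hK.measurableSet fun y hy => ?_
            by_cases hys : y ∈ seenFrom K ε z
            · rw [indicator_of_mem (subset_toMeasurable _ _ hys)]
              exact (hf1 y z).trans le_self_add
            · refine le_trans ?_ le_add_self
              by_cases hyw : y ∈ wetPart K ε
              · obtain ⟨w, hw, hwF⟩ := not_disjoint_iff.1 fun h => hys ⟨hyw, h⟩
                exact hfτ y z w hw hwF
              · exact hfτ y z y (right_mem_segment ℝ z y) ⟨hy, hyw⟩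
        _ = (volume.restrict K) S + τ := by
            rw [lintegral_add_right _ measurable_const, lintegral_indicator_one
              (measurableSet_toMeasurable _ _)]
            simp only [lintegral_const, measure_univ, mul_one, hS]
        _ ≤ _ := by
            refine add_le_add_left ((hle _).trans ?_) _
            rw [ENNReal.le_ofReal_iff_toReal_le (hfin _ fun y hy => hy.1) (maxSeenVolume_nonneg ε)]
            exact le_ciSup (bddAbove_seenVolume hvol ε) ⟨z, hzw⟩
    · refine le_trans ?_ le_add_self
      calc ∫⁻ y in K, f y z ≤ ∫⁻ _y in K, τ := lintegral_mono fun y =>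
            hfτ y z z (left_mem_segment ℝ z y) ⟨hz, hzw⟩
        _ = τ := by simp
  calc pivotMean K n = ∫⁻ y in K, ∫⁻ z in K, f y z :=
        lintegral_congr fun y => pivotProb_zero_eq_lintegral _ n y
    _ = ∫⁻ z in K, ∫⁻ y in K, f y z := lintegral_lintegral_swap hmeas.aemeasurable
    _ ≤ ∫⁻ z in K, (W.indicator (fun _ => ENNReal.ofReal (maxSeenVolume K ε)) z + τ) :=
        setLIntegral_mono' hK.measurableSet hinner
    _ = ENNReal.ofReal (maxSeenVolume K ε) * (volume.restrict K) W + τ := by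
        rw [lintegral_add_right _ measurable_const, lintegral_indicator
          (measurableSet_toMeasurable _ _), setLIntegral_const]
        simp only [lintegral_const, measure_univ, mul_one, hW]
    _ ≤ _ := by
        rw [ENNReal.ofReal_mul (maxSeenVolume_nonneg ε)]
        gcongr
        refine (hle _).trans ?_
        rw [wetVolume, measureReal_def, ENNReal.ofReal_toReal (hfin _ subset_rfl)]

lemma sum_geometric_tail_le {q : ℝ} (hq0 : 0 ≤ q) (hq1 : q < 1) (n m : ℕ) :
    ∑ k ∈ Finset.range m, q ^ (n + k) ≤ q ^ n * (1 - q)⁻¹ := by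
  simp only [pow_add, ← Finset.mul_sum]
  refine mul_le_mul_of_nonneg_left ?_ (pow_nonneg hq0 n)
  rw [← tsum_geometric_of_lt_one hq0 hq1]
  exact (summable_geometric_of_lt_one hq0 hq1).sum_le_tsum _ fun k _ => pow_nonneg hq0 k

/-- With `ε = ν log n / n`, a polynomial factor in `1 / ε` is beaten by the exponential decay
`(1 - ε / 2) ^ h` as soon as `h` is at least a fixed proportion of `n` and `ν` is large. -/
lemma inv_pow_mul_pow_le {n h : ℕ} {ν : ℝ} {c s : ℕ} (hn : 3 ≤ n) (hν : 1 ≤ ν)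
    (hε : ν * Real.log n / n ≤ 1) (hh : (n : ℝ) / 2 ≤ h) (hνc : 4 * (c + s) ≤ ν) :
    (ν * Real.log n / n)⁻¹ ^ c * (1 - ν * Real.log n / n / 2) ^ h ≤ ((n : ℝ) ^ s)⁻¹ := by
  have hn0 : (0 : ℝ) < n := by positivity
  have hlog : 1 ≤ Real.log n := by
    rw [Real.le_log_iff_exp_le hn0]
    have h3 : (3 : ℝ) ≤ n := by exact_mod_cast hn
    linarith [Real.exp_one_lt_d9]
  set ε := ν * Real.log n / n with hεdef
  have hε0 : 0 < ε := by positivity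
  have h1 : ε⁻¹ ≤ n := by
    rw [hεdef, inv_div, div_le_iff₀ (by positivity)]
    exact le_mul_of_one_le_right hn0.le (one_le_mul_of_one_le_of_one_le hν hlog)
  have h2 : (1 - ε / 2) ^ h ≤ ((n : ℝ) ^ (c + s))⁻¹ := by
    calc (1 - ε / 2) ^ h ≤ Real.exp (-(ε / 2)) ^ h := by
          refine pow_le_pow_left₀ (by linarith) ?_ h
          linarith [Real.add_one_le_exp (-(ε / 2))]
      _ = Real.exp (-(ε / 2 * h)) := by rw [← Real.exp_nat_mul]; ring_nf
      _ ≤ Real.exp (-((c + s : ℕ) * Real.log n)) := by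
          refine Real.exp_le_exp.2 (neg_le_neg ?_)
          have h3 : ε * (n / 2) ≤ ε * h := mul_le_mul_of_nonneg_left hh hε0.le
          have h4 : ε * (n / 2) = ν * Real.log n / 2 := by rw [hεdef]; field_simp
          push_cast
          nlinarith
      _ = ((n : ℝ) ^ (c + s))⁻¹ := by
          rw [Real.exp_neg, Real.exp_nat_mul, Real.exp_log hn0]
  have h3 : 0 ≤ (1 - ε / 2) ^ h := pow_nonneg (by linarith) h
  calc ε⁻¹ ^ c * (1 - ε / 2) ^ h ≤ (n : ℝ) ^ c * ((n : ℝ) ^ (c + s))⁻¹ := by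
        gcongr
    _ = ((n : ℝ) ^ s)⁻¹ := by
        rw [pow_add, mul_inv, ← mul_assoc, mul_inv_cancel₀ (by positivity), one_mul]

lemma eventually_mul_log_div_le (ν δ : ℝ) (hδ : 0 < δ) :
    ∃ N : ℕ, ∀ n : ℕ, N ≤ n → ν * Real.log n / n ≤ δ := by
  have h1 : Filter.Tendsto (fun x : ℝ => ν * (Real.log x / x)) Filter.atTop (nhds (ν * 0)) := by
    refine Filter.Tendsto.const_mul _ ?_
    simpa using Real.isLittleO_log_id_atTop.tendsto_div_nhds_zero
  rw [mul_zero] at h1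
  have h2 := (h1.comp tendsto_natCast_atTop_atTop).eventually_lt_const hδ
  obtain ⟨N, hN⟩ := Filter.eventually_atTop.1 h2
  refine ⟨N, fun n hn => ?_⟩
  have := hN n hn
  simp only [Function.comp] at this
  rw [mul_div_assoc]
  exact this.le

/-- The bound by `g` and `ρ` for a body of positive dimension, with leading constant one. -/
theorem increment_le_of_floatingBody (hd : 0 < d) (hK : IsCompact K) (hconv : Convex ℝ K)
    (hvol : volume K = 1) : ∃ ν₀ : ℝ, 0 < ν₀ ∧ ∀ ν : ℝ, ν₀ ≤ ν → ∃ N : ℕ, ∀ n : ℕ, N ≤ n → ∀ m : ℕ,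
      |expectedHullVolume K (n + m) - expectedHullVolume K n|
        ≤ maxSeenVolume K (ν * Real.log n / n) * m * wetVolume K (ν * Real.log n / n)
          + maxSeenVolume K (ν * Real.log n / n) * Real.log n := by
  obtain ⟨C, hC, hmiss⟩ := exists_missProb_le_of_isDeep hK hvol
  refine ⟨4 * ((d + 1 : ℕ) + (2 : ℕ)), by positivity, fun ν hν => ?_⟩
  have hν1 : 1 ≤ ν := by
    refine le_trans ?_ hν
    push_cast
    have : (0 : ℝ) ≤ d := by positivity
    linarith
  obtain ⟨N, hN⟩ := eventually_mul_log_div_le ν 1 one_pos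
  refine ⟨max (max N 3) ⌈2 * C⌉₊, fun n hn m => ?_⟩
  have hn3 : 3 ≤ n := (le_max_right N 3).trans ((le_max_left _ _).trans hn)
  have hε1 : ν * Real.log n / n ≤ 1 := hN n ((le_max_left N 3).trans ((le_max_left _ _).trans hn))
  have hCn : 2 * C ≤ n := (Nat.le_ceil _).trans (by exact_mod_cast (le_max_right _ _).trans hn)
  have hn0 : (0 : ℝ) < n := by positivity
  have hlog : 1 ≤ Real.log n := by
    rw [Real.le_log_iff_exp_le hn0]
    have h3 : (3 : ℝ) ≤ n := by exact_mod_cast hn3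
    linarith [Real.exp_one_lt_d9]
  have hpoly := inv_pow_mul_pow_le (h := n) (c := d + 1) (s := 2) hn3 hν1 hε1
    (by linarith) hν
  have hεn : (n : ℝ)⁻¹ ≤ ν * Real.log n / n := by
    rw [inv_eq_one_div]
    gcongr
    nlinarith
  set ε := ν * Real.log n / n with hε
  clear_value ε
  have hε0 : 0 < ε := lt_of_lt_of_le (by positivity) hεn
  have hg := le_maxSeenVolume hd hK hconv hvol hε0 hε1
  have hρ : 0 ≤ wetVolume K ε := measureReal_nonneg
  have hq0 : 0 ≤ 1 - ε / 2 := by linarith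
  set τ : ℕ → ℝ := fun k => C * ε⁻¹ ^ d * (1 - ε / 2) ^ k with hτ
  have hτ0 : ∀ k, 0 ≤ τ k := fun k => by positivity
  have hone : ∀ k, pivotMean K k ≤
      ENNReal.ofReal (maxSeenVolume K ε * wetVolume K ε + τ k) := by
    intro k
    rw [ENNReal.ofReal_add (mul_nonneg (maxSeenVolume_nonneg ε) hρ) (hτ0 k)]
    exact pivotMean_le_of_floatingBody hK hvol ε k fun w hw =>
      hmiss ε hε0 hε1 w hw.1 (isDeep_of_mem_floatingBody hK hvol hε1 hw) k
  have htail : ∑ k ∈ Finset.range m, τ (n + k) ≤ maxSeenVolume K ε * Real.log n := by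
    calc ∑ k ∈ Finset.range m, τ (n + k)
        = C * ε⁻¹ ^ d * ∑ k ∈ Finset.range m, (1 - ε / 2) ^ (n + k) := by
          rw [Finset.mul_sum]
      _ ≤ C * ε⁻¹ ^ d * ((1 - ε / 2) ^ n * (1 - (1 - ε / 2))⁻¹) := by
          gcongr
          exact sum_geometric_tail_le hq0 (by linarith) n m
      _ = 2 * C * (ε⁻¹ ^ (d + 1) * (1 - ε / 2) ^ n) := by
          rw [sub_sub_cancel, pow_succ, inv_div, div_eq_mul_inv]
          ring
      _ ≤ n * ((n : ℝ) ^ 2)⁻¹ := by gcongr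
      _ = (n : ℝ)⁻¹ := by field_simp
      _ ≤ maxSeenVolume K ε := hεn.trans hg
      _ ≤ maxSeenVolume K ε * Real.log n := le_mul_of_one_le_right (maxSeenVolume_nonneg ε) hlog
  have hg0 := maxSeenVolume_nonneg (K := K) ε
  refine abs_expectedHullVolume_sub_le hK hconv hvol (by positivity) ?_
  calc ∑ k ∈ Finset.range m, pivotMean K (n + k)
      ≤ ∑ k ∈ Finset.range m, ENNReal.ofReal (maxSeenVolume K ε * wetVolume K ε + τ (n + k)) :=
        Finset.sum_le_sum fun k _ => hone _
    _ = ENNReal.ofReal (∑ k ∈ Finset.range m, (maxSeenVolume K ε * wetVolume K ε + τ (n + k))) :=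
        (ENNReal.ofReal_sum_of_nonneg fun k _ =>
          add_nonneg (mul_nonneg (maxSeenVolume_nonneg ε) hρ) (hτ0 _)).symm
    _ ≤ _ := by
        refine ENNReal.ofReal_le_ofReal ?_
        rw [Finset.sum_add_distrib, Finset.sum_const, Finset.card_range, nsmul_eq_mul]
        linarith

end FloatingBody

/-! ### Increments and points of small depth -/

section SmallDepth

open Set
open scoped ENNReal

variable {d : ℕ} {K : Set (EuclideanSpace ℝ (Fin d))}

/-- A bound on the volume of the points of depth less than `ε = 4 (d + 1) log n / n` controls the
increments of `μ` from `n` on. -/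
lemma exists_abs_sub_le_of_volume_not_isDeep (hK : IsCompact K) (hconv : Convex ℝ K)
    (hvol : volume K = 1) : ∃ C : ℝ, 1 ≤ C ∧ ∃ N : ℕ, ∀ n : ℕ, N ≤ n → ∀ v : ℝ, 0 ≤ v →
      volume {y ∈ K | ¬ IsDeep K (4 * (d + 1) * Real.log n / n) y} ≤ ENNReal.ofReal v → ∀ m : ℕ,
      |expectedHullVolume K (n + m) - expectedHullVolume K n|
        ≤ m * (2 * (d + 1) * (v + C * (n : ℝ)⁻¹) / n) := by
  obtain ⟨C, hC, hmiss⟩ := exists_missMean_le hK hvol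
  obtain ⟨N, hN⟩ := eventually_mul_log_div_le (4 * (d + 1)) 1 one_pos
  refine ⟨C, hC, max N 3, fun n hn v hv hvle m => ?_⟩
  have hn3 : 3 ≤ n := (le_max_right N 3).trans hn
  have hε1 := hN n ((le_max_left N 3).trans hn)
  have hn0 : (0 : ℝ) < n := by positivity
  have hlog : 0 < Real.log n := Real.log_pos (by exact_mod_cast (by omega : 1 < n))
  have hd0 : (0 : ℝ) ≤ d := by positivity
  have hhalf : (n : ℝ) / 2 ≤ ((n + 1) / 2 : ℕ) := by
    rw [div_le_iff₀ two_pos]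
    exact_mod_cast (by omega : n ≤ (n + 1) / 2 * 2)
  have hpoly := inv_pow_mul_pow_le (h := (n + 1) / 2) (ν := 4 * (d + 1)) (c := d) (s := 1) hn3
    (by linarith) hε1 hhalf (by push_cast; exact le_rfl)
  have hε0 : 0 < 4 * (d + 1) * Real.log n / n := by positivity
  refine abs_expectedHullVolume_sub_le_of_missMean_le hK hconv hvol (by omega) m (by positivity) ?_
  rw [ENNReal.ofReal_add hv (by positivity)]
  refine (hmiss _ hε0 hε1 _).trans (add_le_add hvle (ENNReal.ofReal_le_ofReal ?_))
  rw [mul_assoc]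
  rw [pow_one] at hpoly
  gcongr

/-! ### Polytopes -/

lemma volume_box (l u : Fin d → ℝ) :
    volume {v : EuclideanSpace ℝ (Fin d) | ∀ i, v i ∈ Icc (l i) (u i)} =
      ∏ i, ENNReal.ofReal (u i - l i) := by
  have h := (PiLp.volume_preserving_ofLp (Fin d)).measure_preimage
    (MeasurableSet.univ_pi fun i => measurableSet_Icc (a := l i) (b := u i)).nullMeasurableSet
  rw [volume_pi_pi] at h
  simp only [Real.volume_Icc] at h
  rw [← h]
  congr 1
  ext v
  exact ⟨fun h i _ => h i, fun h i => h i trivial⟩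

/-- The part of the unit cube on which the product of the coordinates is at most `t` has volume
almost `t`: this is Markov's inequality for `∏ vᵢ ^ (δ - 1)`. -/
lemma volume_prod_le {t δ : ℝ} (ht : 0 < t) (hδ : 0 < δ) (hδ1 : δ < 1) :
    volume {v : EuclideanSpace ℝ (Fin d) | (∀ i, v i ∈ Icc (0 : ℝ) 1) ∧ ∏ i, v i ≤ t} ≤
      ENNReal.ofReal (t ^ (1 - δ) * δ⁻¹ ^ d) := by
  set ν : Measure ℝ := volume.restrict (Ioc 0 1) with hν
  set π := Measure.pi (fun _ : Fin d => ν) with hπ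
  have hprob : IsProbabilityMeasure ν := ⟨by simp [hν]⟩
  have hm : MeasurableSet {v : Fin d → ℝ | ∏ i, v i ≤ t} :=
    measurableSet_le (by fun_prop) measurable_const
  have h1 : volume {v : EuclideanSpace ℝ (Fin d) | (∀ i, v i ∈ Icc (0 : ℝ) 1) ∧ ∏ i, v i ≤ t} =
      π {v | ∏ i, v i ≤ t} := by
    have h2 : π = volume.restrict (univ.pi fun _ : Fin d => Icc (0 : ℝ) 1) := by
      rw [hπ, hν, restrict_Ioc_eq_restrict_Icc, volume_pi, Measure.restrict_pi_pi]
    rw [h2, Measure.restrict_apply hm, ← (PiLp.volume_preserving_ofLp (Fin d)).measure_preimage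
      (hm.inter (MeasurableSet.univ_pi fun i => measurableSet_Icc)).nullMeasurableSet]
    congr 1
    ext v
    exact ⟨fun h => ⟨h.2, fun i _ => h.1 i⟩, fun h => ⟨fun i => h.2 i trivial, h.1⟩⟩
  have hint : IntegrableOn (fun x : ℝ => x ^ (δ - 1)) (Ioc 0 1) := by
    rw [← intervalIntegrable_iff_integrableOn_Ioc_of_le zero_le_one]
    exact intervalIntegral.intervalIntegrable_rpow' (by linarith)
  have hval : ∫ x, x ^ (δ - 1) ∂ν = δ⁻¹ := by
    rw [hν, ← intervalIntegral.integral_of_le zero_le_one, integral_rpow (by left; linarith)]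
    simp [hδ.ne']
  have hI : ∫ v, ∏ i, v i ^ (δ - 1) ∂π = δ⁻¹ ^ d := by
    rw [hπ, integral_fintype_prod_eq_prod (fun _ : Fin d => fun x : ℝ => x ^ (δ - 1))]
    simp [hval]
  have hpos : ∀ᵐ v ∂π, ∀ i, 0 < v i := by
    rw [ae_all_iff]
    intro i
    refine (measurePreserving_eval (fun _ : Fin d => ν) i).quasiMeasurePreserving.ae ?_
    filter_upwards [ae_restrict_mem measurableSet_Ioc] with x hx using hx.1
  have hmarkov := mul_meas_ge_le_integral_of_nonneg (μ := π)
    (f := fun v : Fin d → ℝ => ∏ i, v i ^ (δ - 1))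
    (by
      filter_upwards [hpos] with v hv
      exact Finset.prod_nonneg fun i _ => Real.rpow_nonneg (hv i).le _)
    (Integrable.fintype_prod fun _ => hint) (t ^ (δ - 1))
  rw [hI] at hmarkov
  have hle : π {v | ∏ i, v i ≤ t} ≤ π {v | t ^ (δ - 1) ≤ ∏ i, v i ^ (δ - 1)} := by
    refine measure_mono_ae ?_
    filter_upwards [hpos] with v hv hvt
    change t ^ (δ - 1) ≤ ∏ i, v i ^ (δ - 1)
    rw [Real.finsetProd_rpow _ _ fun i _ => (hv i).le]
    exact Real.rpow_le_rpow_of_nonpos (Finset.prod_pos fun i _ => hv i) hvt (by linarith)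
  rw [h1]
  refine hle.trans ?_
  refine (ENNReal.le_ofReal_iff_toReal_le (measure_ne_top _ _) (by positivity)).2 ?_
  have h3 : t ^ (1 - δ) * t ^ (δ - 1) = 1 := by
    rw [← Real.rpow_add ht]; simp
  calc (π {v | t ^ (δ - 1) ≤ ∏ i, v i ^ (δ - 1)}).toReal
      = t ^ (1 - δ) * (t ^ (δ - 1) * (π {v | t ^ (δ - 1) ≤ ∏ i, v i ^ (δ - 1)}).toReal) := by
        rw [← mul_assoc, h3, one_mul]
    _ ≤ _ := by
        gcongr
        exact hmarkov

/-- The linear map that sends the `i`-th basis vector to the edge from `b 0` to `b (i + 1)`. -/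
noncomputable def edgeMap (b : Fin (d + 1) → EuclideanSpace ℝ (Fin d)) :
    EuclideanSpace ℝ (Fin d) →ₗ[ℝ] EuclideanSpace ℝ (Fin d) :=
  Fintype.linearCombination ℝ (fun i : Fin d => b i.succ - b 0) ∘ₗ
    (WithLp.linearEquiv 2 ℝ (Fin d → ℝ)).toLinearMap

lemma edgeMap_apply (b : Fin (d + 1) → EuclideanSpace ℝ (Fin d)) (v : EuclideanSpace ℝ (Fin d)) :
    edgeMap b v = ∑ i, v i • (b i.succ - b 0) := by
  simp [edgeMap, Fintype.linearCombination_apply]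

lemma sum_smul_eq_add_edgeMap (b : Fin (d + 1) → EuclideanSpace ℝ (Fin d)) {w : Fin (d + 1) → ℝ}
    (hw : ∑ i, w i = 1) :
    ∑ i, w i • b i = b 0 + edgeMap b (WithLp.toLp 2 fun i => w i.succ) := by
  rw [Fin.sum_univ_succ] at hw ⊢
  rw [edgeMap_apply]
  simp only [smul_sub, Finset.sum_sub_distrib, ← Finset.sum_smul]
  rw [eq_sub_of_add_eq hw, sub_smul, one_smul]
  abel

lemma add_edgeMap_mem_convexHull (b : Fin (d + 1) → EuclideanSpace ℝ (Fin d))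
    {v : EuclideanSpace ℝ (Fin d)} (hv : ∀ i, 0 ≤ v i) (hv1 : ∑ i, v i ≤ 1) :
    b 0 + edgeMap b v ∈ convexHull ℝ (range b) := by
  let w : Fin (d + 1) → ℝ := Fin.cons (1 - ∑ i, v i) fun i => v i
  have hw : ∑ i, w i = 1 := by simp [w, Fin.sum_univ_succ]
  rw [convexHull_range_eq_image_stdSimplex]
  refine ⟨w, ⟨fun i => ?_, hw⟩, ?_⟩
  · refine Fin.cases ?_ (fun j => ?_) i
    · simpa [w] using hv1
    · simpa [w] using hv j
  · change ∑ i, w i • b i = _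
    rw [sum_smul_eq_add_edgeMap b hw]
    rfl

/-- A polytope is covered by the corners of the simplices spanned by its vertices: by
Carathéodory's theorem every point is a convex combination of `d + 1` of the vertices, and one of
the weights is at least `1 / (d + 1)`. -/
lemma exists_eq_add_edgeMap {V : Set (EuclideanSpace ℝ (Fin d))} {y : EuclideanSpace ℝ (Fin d)}
    (hy : y ∈ convexHull ℝ V) : ∃ (b : Fin (d + 1) → V) (v : EuclideanSpace ℝ (Fin d)),
      (∀ i, 0 ≤ v i) ∧ ∑ i, v i ≤ d / (d + 1) ∧
      y = b 0 + edgeMap (fun i => (b i : EuclideanSpace ℝ (Fin d))) v := by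
  rw [convexHull_eq_union] at hy
  simp only [mem_iUnion] at hy
  obtain ⟨t, htV, hind, hyt⟩ := hy
  have hcard : Fintype.card t ≤ Fintype.card (Fin (d + 1)) := by
    have h := hind.card_le_finrank_succ
    have h2 := Submodule.finrank_le (vectorSpan ℝ (range ((↑) : t → EuclideanSpace ℝ (Fin d))))
    rw [finrank_euclideanSpace_fin] at h2
    rw [Fintype.card_fin]
    omega
  have hne : Nonempty t := by
    obtain ⟨x, hx⟩ := (convexHull_nonempty_iff (𝕜 := ℝ)).1 ⟨y, hyt⟩
    exact ⟨⟨x, hx⟩⟩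
  obtain ⟨e⟩ := Function.Embedding.nonempty_of_card_le hcard
  let f : Fin (d + 1) → t := Function.invFun e
  let c : Fin (d + 1) → V := fun i => ⟨f i, htV (f i).2⟩
  have hrange : (t : Set (EuclideanSpace ℝ (Fin d))) ⊆
      range fun i => (c i : EuclideanSpace ℝ (Fin d)) := by
    intro x hx
    obtain ⟨i, hi⟩ := Function.invFun_surjective e.injective ⟨x, hx⟩
    exact ⟨i, congrArg Subtype.val hi⟩
  have hyc := convexHull_mono (𝕜 := ℝ) hrange hyt
  rw [convexHull_range_eq_image_stdSimplex] at hyc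
  obtain ⟨w, ⟨hw0, hw1⟩, rfl⟩ := hyc
  obtain ⟨i₀, hi₀⟩ := Finite.exists_max w
  have hmax : 1 / ((d : ℝ) + 1) ≤ w i₀ := by
    rw [div_le_iff₀ (by positivity)]
    calc (1 : ℝ) = ∑ i, w i := hw1.symm
      _ ≤ ∑ _i : Fin (d + 1), w i₀ := Finset.sum_le_sum fun i _ => hi₀ i
      _ = w i₀ * (d + 1) := by simp; ring
  let σ := Equiv.swap 0 i₀
  have hσ0 : σ 0 = i₀ := Equiv.swap_apply_left 0 i₀
  have hsum : ∑ i, w (σ i) = 1 := by rw [Equiv.sum_comp σ w, hw1]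
  refine ⟨c ∘ σ, WithLp.toLp 2 fun i => w (σ i.succ), fun i => hw0 _, ?_, ?_⟩
  · have h := hsum
    rw [Fin.sum_univ_succ, hσ0] at h
    have h2 : (d : ℝ) / (d + 1) = 1 - 1 / (d + 1) := by field_simp; ring
    rw [h2]
    simp only
    linarith
  · have h := sum_smul_eq_add_edgeMap (fun i => ((c ∘ σ) i : EuclideanSpace ℝ (Fin d))) hsum
    simp only [← h]
    exact (Equiv.sum_comp σ fun i => w i • (c i : EuclideanSpace ℝ (Fin d))).symm

/-- The depth of a point in the corner of a simplex is at least a constant times the product of its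
coordinates: a half-space at the point contains, in these coordinates, one of the orthants at it. -/
lemma isDeep_add_edgeMap (hK : IsCompact K) {b : Fin (d + 1) → EuclideanSpace ℝ (Fin d)}
    (hb : convexHull ℝ (range b) ⊆ K) {v : EuclideanSpace ℝ (Fin d)} (hv : ∀ i, 0 ≤ v i)
    (hv1 : ∑ i, v i ≤ d / (d + 1)) :
    IsDeep K (|(edgeMap b).det| * ((d + 1 : ℝ)⁻¹ ^ d * ∏ i, v i)) (b 0 + edgeMap b v) := by
  intro a _
  set θ : ℝ := (d + 1 : ℝ)⁻¹ with hθ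
  have hθ0 : 0 < θ := by positivity
  have hθ1 : θ ≤ 1 := inv_le_one_of_one_le₀ (by linarith [(Nat.cast_nonneg d : (0 : ℝ) ≤ d)])
  let α : Fin d → ℝ := fun i => inner ℝ a (b i.succ - b 0)
  let l : Fin d → ℝ := fun i => if 0 ≤ α i then v i else v i - θ * v i
  let u : Fin d → ℝ := fun i => if 0 ≤ α i then v i + θ * v i else v i
  let B : Set (EuclideanSpace ℝ (Fin d)) := {w | ∀ i, w i ∈ Icc (l i) (u i)}
  have hvB : volume B = ENNReal.ofReal (θ ^ d * ∏ i, v i) := by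
    rw [volume_box, ← ENNReal.ofReal_prod_of_nonneg]
    · congr 1
      have hθd : θ ^ d = ∏ _i : Fin d, θ := by simp
      rw [hθd, ← Finset.prod_mul_distrib]
      refine Finset.prod_congr rfl fun i _ => ?_
      simp only [l, u]
      split_ifs <;> ring
    · intro i _
      have := mul_nonneg hθ0.le (hv i)
      simp only [l, u]
      split_ifs <;> linarith
  have himg : (fun w => b 0 + edgeMap b w) '' B ⊆
      K ∩ {z | inner ℝ a (b 0 + edgeMap b v) ≤ inner ℝ a z} := by
    rintro _ ⟨w, hw, rfl⟩
    have hwl : ∀ i, 0 ≤ w i := fun i => by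
      have h1 := (hw i).1
      have h2 := hv i
      simp only [l] at h1
      split_ifs at h1 <;> nlinarith
    have hwu : ∀ i, w i ≤ (1 + θ) * v i := fun i => by
      have h1 := (hw i).2
      have h2 := mul_nonneg hθ0.le (hv i)
      simp only [u] at h1
      split_ifs at h1 <;> linarith
    have hwsum : ∑ i, w i ≤ 1 := by
      calc ∑ i, w i ≤ ∑ i, (1 + θ) * v i := Finset.sum_le_sum fun i _ => hwu i
        _ = (1 + θ) * ∑ i, v i := by rw [Finset.mul_sum]
        _ ≤ (1 + θ) * (d / (d + 1)) := by gcongr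
        _ = 1 - θ ^ 2 := by rw [hθ]; field_simp; ring
        _ ≤ 1 := by linarith [sq_nonneg θ]
    refine ⟨hb (add_edgeMap_mem_convexHull b hwl hwsum), ?_⟩
    have hinner : ∀ x : EuclideanSpace ℝ (Fin d),
        inner ℝ a (b 0 + edgeMap b x) = inner ℝ a (b 0) + ∑ i, x i * α i := by
      intro x
      rw [inner_add_right, edgeMap_apply, inner_sum]
      simp only [real_inner_smul_right, α]
    simp only [mem_ofPred_eq, hinner]
    refine add_le_add_right (Finset.sum_le_sum fun i _ => ?_) _
    obtain ⟨h1, h2⟩ := hw i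
    simp only [l, u] at h1 h2
    split_ifs at h1 h2 with h
    · exact mul_le_mul_of_nonneg_right h1 h
    · exact mul_le_mul_of_nonpos_right h2 (not_le.1 h).le
  have hfin : volume (K ∩ {z | inner ℝ a (b 0 + edgeMap b v) ≤ inner ℝ a z}) ≠ ∞ :=
    ((measure_mono inter_subset_left).trans_lt hK.measure_lt_top).ne
  have hprod : 0 ≤ ∏ i, v i := Finset.prod_nonneg fun i _ => hv i
  have h1 : volume ((fun w => b 0 + edgeMap b w) '' B) =
      ENNReal.ofReal (|(edgeMap b).det| * (θ ^ d * ∏ i, v i)) := by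
    rw [← image_image (fun z => b 0 + z) (edgeMap b) B, image_add_left, measure_preimage_add,
      Measure.addHaar_image_linearMap, hvB, ← ENNReal.ofReal_mul (abs_nonneg _)]
  have h2 := (measure_mono himg : volume _ ≤ volume _)
  rw [h1] at h2
  rw [measureReal_def, ← ENNReal.toReal_ofReal (r := |(edgeMap b).det| * (θ ^ d * ∏ i, v i))
    (by positivity)]
  exact ENNReal.toReal_mono hfin h2

/-- In a polytope the points of depth less than `ε` have volume `O(ε ^ (1 - δ) δ⁻ᵈ)`. Degenerate
simplices, whose edges are linearly dependent, contribute nothing. -/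
lemma exists_volume_not_isDeep_le_of_isConvexPolytope (hK : IsCompact K)
    (hpoly : IsConvexPolytope K) :
    ∃ C : ℝ, 0 ≤ C ∧ ∀ ε δ : ℝ, 0 < ε → 0 < δ → δ < 1 →
      volume {y ∈ K | ¬ IsDeep K ε y} ≤ ENNReal.ofReal (C * (ε ^ (1 - δ) * δ⁻¹ ^ d)) := by
  obtain ⟨V, hVfin, hKV⟩ := hpoly
  have := hVfin.fintype
  let bb : (Fin (d + 1) → V) → Fin (d + 1) → EuclideanSpace ℝ (Fin d) := fun b i => b i
  let D : (Fin (d + 1) → V) → ℝ := fun b => |(edgeMap (bb b)).det|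
  let c : (Fin (d + 1) → V) → ℝ := fun b => (D b * (d + 1 : ℝ)⁻¹ ^ d)⁻¹
  have hD0 : ∀ b, 0 ≤ D b := fun b => abs_nonneg _
  have hc0 : ∀ b, 0 ≤ c b := fun b => inv_nonneg.2 (mul_nonneg (hD0 b) (by positivity))
  refine ⟨∑ b, D b * max 1 (c b), Finset.sum_nonneg fun b _ => by have := hD0 b; positivity,
    fun ε δ hε hδ hδ1 => ?_⟩
  let S : (Fin (d + 1) → V) → Set (EuclideanSpace ℝ (Fin d)) := fun b =>
    {v | (∀ i, v i ∈ Icc (0 : ℝ) 1) ∧ (0 < D b → ∏ i, v i ≤ ε * c b)}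
  have hcover : {y ∈ K | ¬ IsDeep K ε y} ⊆
      ⋃ b, (fun z => bb b 0 + z) '' (edgeMap (bb b) '' S b) := by
    rintro y ⟨hyK, hy⟩
    rw [hKV] at hyK
    obtain ⟨b, v, hv0, hv1, rfl⟩ := exists_eq_add_edgeMap hyK
    refine mem_iUnion.2 ⟨b, _, ⟨v, ⟨fun i => ⟨hv0 i, ?_⟩, fun hD => ?_⟩, rfl⟩, rfl⟩
    · calc v i ≤ ∑ j, v j := Finset.single_le_sum (fun j _ => hv0 j) (Finset.mem_univ i)
        _ ≤ d / (d + 1) := hv1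
        _ ≤ 1 := div_le_one_of_le₀ (by linarith) (by positivity)
    · by_contra! hlt
      refine hy fun a ha => ?_
      have hsub : convexHull ℝ (range (bb b)) ⊆ K := by
        rw [hKV]
        exact convexHull_mono (range_subset_iff.2 fun i => (b i).2)
      refine le_trans ?_ (isDeep_add_edgeMap hK hsub hv0 hv1 a ha)
      have hDc : 0 < D b * (d + 1 : ℝ)⁻¹ ^ d := by positivity
      simp only [c] at hlt
      rw [← div_eq_mul_inv, div_lt_iff₀ hDc] at hlt
      linarith
  have hone : ∀ b, volume ((fun z => bb b 0 + z) '' (edgeMap (bb b) '' S b)) ≤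
      ENNReal.ofReal (D b * max 1 (c b) * (ε ^ (1 - δ) * δ⁻¹ ^ d)) := by
    intro b
    rw [image_add_left, measure_preimage_add, Measure.addHaar_image_linearMap]
    change ENNReal.ofReal (D b) * _ ≤ _
    rcases (hD0 b).eq_or_lt with h | h
    · rw [← h]; simp
    have hcpos : 0 < c b := inv_pos.2 (by positivity)
    rw [mul_assoc, ENNReal.ofReal_mul (hD0 b)]
    gcongr
    have hSle : S b ⊆ {v | (∀ i, v i ∈ Icc (0 : ℝ) 1) ∧ ∏ i, v i ≤ ε * c b} :=
      fun v hv => ⟨hv.1, hv.2 h⟩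
    refine (measure_mono hSle).trans ((volume_prod_le (by positivity) hδ hδ1).trans ?_)
    refine ENNReal.ofReal_le_ofReal ?_
    rw [Real.mul_rpow hε.le hcpos.le]
    have h1 : c b ^ (1 - δ) ≤ max 1 (c b) := by
      calc c b ^ (1 - δ) ≤ max 1 (c b) ^ (1 - δ) := by
            gcongr
            exact le_max_right _ _
        _ ≤ max 1 (c b) ^ (1 : ℝ) := Real.rpow_le_rpow_of_exponent_le (le_max_left _ _) (by linarith)
        _ = _ := Real.rpow_one _
    calc ε ^ (1 - δ) * c b ^ (1 - δ) * δ⁻¹ ^ d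
        = c b ^ (1 - δ) * (ε ^ (1 - δ) * δ⁻¹ ^ d) := by ring
      _ ≤ _ := by gcongr
  calc volume {y ∈ K | ¬ IsDeep K ε y}
      ≤ ∑ b, volume ((fun z => bb b 0 + z) '' (edgeMap (bb b) '' S b)) :=
        (measure_mono hcover).trans (measure_iUnion_fintype_le _ _)
    _ ≤ ∑ b, ENNReal.ofReal (D b * max 1 (c b) * (ε ^ (1 - δ) * δ⁻¹ ^ d)) :=
        Finset.sum_le_sum fun b _ => hone b
    _ = _ := by
        rw [← ENNReal.ofReal_sum_of_nonneg, Finset.sum_mul]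
        intro b _
        have := hD0 b
        positivity

theorem increment_le_of_isConvexPolytope (hK : IsCompact K) (hconv : Convex ℝ K)
    (hvol : volume K = 1) (hpoly : IsConvexPolytope K) :
    ∃ (C : ℝ) (A N : ℕ), ∀ n : ℕ, N ≤ n → ∀ m : ℕ,
      |expectedHullVolume K (n + m) - expectedHullVolume K n|
        ≤ C * ((m * (n : ℝ)⁻¹ + 1) * (n : ℝ)⁻¹ * Real.log n ^ A) := by
  obtain ⟨C₁, hC₁, N, hN⟩ := exists_abs_sub_le_of_volume_not_isDeep hK hconv hvol
  obtain ⟨C₂, hC₂, hdeep⟩ := exists_volume_not_isDeep_le_of_isConvexPolytope hK hpoly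
  set ν : ℝ := 4 * (d + 1) with hν
  have hν1 : 1 ≤ ν := by
    have : (0 : ℝ) ≤ d := by positivity
    linarith
  set B : ℝ := C₂ * (ν * Real.exp 1) + C₁ with hB
  refine ⟨2 * (d + 1) * B, d + 1, max N 3, fun n hn m => ?_⟩
  have hn3 : 3 ≤ n := (le_max_right N 3).trans hn
  have hn0 : (0 : ℝ) < n := by positivity
  have hlog : 1 < Real.log n := by
    rw [Real.lt_log_iff_exp_lt hn0]
    have h3 : (3 : ℝ) ≤ n := by exact_mod_cast hn3
    linarith [Real.exp_one_lt_d9]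
  set ℓ := Real.log n with hℓ
  have hℓ0 : 0 < ℓ := by linarith
  have hδ0 : 0 < ℓ⁻¹ := by positivity
  have hδ1 : ℓ⁻¹ < 1 := inv_lt_one_of_one_lt₀ hlog
  set ε := ν * ℓ / n with hε
  have hεn : (n : ℝ)⁻¹ ≤ ε := by
    rw [inv_eq_one_div, hε]
    gcongr
    nlinarith
  have hε0 : 0 < ε := by positivity
  -- With `δ = 1 / log n` the factor `ε ^ (-δ)` is at most `n ^ (1 / log n) = e`.
  have hpow : ε ^ (1 - ℓ⁻¹) ≤ ε * Real.exp 1 := by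
    rw [Real.rpow_sub hε0, Real.rpow_one, div_eq_mul_inv, ← Real.inv_rpow hε0.le]
    gcongr
    calc ε⁻¹ ^ ℓ⁻¹ ≤ (n : ℝ) ^ ℓ⁻¹ := by
          gcongr
          exact inv_le_of_inv_le₀ hn0 hεn
      _ = Real.exp 1 := by
          rw [Real.rpow_def_of_pos hn0, ← hℓ, mul_inv_cancel₀ hℓ0.ne']
  have hv : C₂ * (ε ^ (1 - ℓ⁻¹) * ℓ⁻¹⁻¹ ^ d) ≤ C₂ * (ν * Real.exp 1) * (n : ℝ)⁻¹ * ℓ ^ (d + 1) := by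
    calc C₂ * (ε ^ (1 - ℓ⁻¹) * ℓ⁻¹⁻¹ ^ d) ≤ C₂ * ((ε * Real.exp 1) * ℓ ^ d) := by
          rw [inv_inv]
          gcongr
      _ = _ := by rw [hε, div_eq_mul_inv, pow_succ]; ring
  have key := hN n ((le_max_left N 3).trans hn) _ (by positivity)
    ((hdeep ε ℓ⁻¹ hε0 hδ0 hδ1).trans (ENNReal.ofReal_le_ofReal hv)) m
  have hℓ1 : 1 ≤ ℓ ^ (d + 1) := one_le_pow₀ hlog.le
  calc |expectedHullVolume K (n + m) - expectedHullVolume K n|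
      ≤ m * (2 * (d + 1) * (C₂ * (ν * Real.exp 1) * (n : ℝ)⁻¹ * ℓ ^ (d + 1) + C₁ * (n : ℝ)⁻¹) / n) :=
        key
    _ ≤ m * (2 * (d + 1) * (C₂ * (ν * Real.exp 1) * (n : ℝ)⁻¹ * ℓ ^ (d + 1)
          + C₁ * (n : ℝ)⁻¹ * ℓ ^ (d + 1)) / n) := by
        gcongr m * (2 * (d + 1) * (_ + ?_) / n)
        exact le_mul_of_one_le_right (by positivity) hℓ1
    _ = 2 * (d + 1) * B * ((m * (n : ℝ)⁻¹ + 0) * (n : ℝ)⁻¹ * ℓ ^ (d + 1)) := by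
        rw [hB, div_eq_mul_inv]; ring
    _ ≤ 2 * (d + 1) * B * ((m * (n : ℝ)⁻¹ + 1) * (n : ℝ)⁻¹ * ℓ ^ (d + 1)) := by
        have : 0 ≤ B := by positivity
        gcongr
        exact zero_le_one

end SmallDepth

/-! ### Smooth bodies -/

section Smooth

open Set
open scoped ENNReal Topology

variable {d : ℕ} {K : Set (EuclideanSpace ℝ (Fin d))}

/-- A one-sided second-order Taylor estimate from an upper bound on the second derivative. -/
lemma le_taylor_of_fderiv_fderiv_le {F : Type*} [NormedAddCommGroup F] [NormedSpace ℝ F]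
    {h : F → ℝ} {s : Set F} (hs : Convex ℝ s) {M : ℝ}
    (hd : ∀ y ∈ s, DifferentiableAt ℝ h y ∧ DifferentiableAt ℝ (fderiv ℝ h) y)
    (hM : ∀ y ∈ s, ∀ w, fderiv ℝ (fderiv ℝ h) y w w ≤ 2 * M * ‖w‖ ^ 2)
    {y z : F} (hy : y ∈ s) (hz : z ∈ s) :
    h z ≤ h y + fderiv ℝ h y (z - y) + M * ‖z - y‖ ^ 2 := by
  set w := z - y with hw
  have hmem : ∀ t ∈ Icc (0 : ℝ) 1, y + t • w ∈ s := fun t ht =>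
    hs.add_smul_sub_mem hy hz ht
  have hline : ∀ t : ℝ, HasDerivAt (fun t : ℝ => y + t • w) w t := fun t => by
    simpa using ((hasDerivAt_id t).smul_const w).const_add y
  have h1 : ∀ t ∈ Icc (0 : ℝ) 1,
      HasDerivAt (fun t : ℝ => h (y + t • w)) (fderiv ℝ h (y + t • w) w) t := fun t ht =>
    (hd _ (hmem t ht)).1.hasFDerivAt.comp_hasDerivAt t (hline t)
  have h2 : ∀ t ∈ Icc (0 : ℝ) 1, HasDerivAt (fun t : ℝ => fderiv ℝ h (y + t • w) w)
      (fderiv ℝ (fderiv ℝ h) (y + t • w) w w) t := fun t ht => by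
    have := (hd _ (hmem t ht)).2.hasFDerivAt.comp_hasDerivAt t (hline t)
    exact (((ContinuousLinearMap.apply ℝ ℝ w).hasFDerivAt).comp_hasDerivAt t this)
  have h3 : ∀ t ∈ Icc (0 : ℝ) 1,
      fderiv ℝ h (y + t • w) w - fderiv ℝ h y w ≤ 2 * M * ‖w‖ ^ 2 * t := by
    intro t ht
    have := (convex_Icc (0 : ℝ) 1).image_sub_le_mul_sub_of_deriv_le
      (f := fun t : ℝ => fderiv ℝ h (y + t • w) w)
      (fun t ht => (h2 t ht).continuousAt.continuousWithinAt)
      (fun t ht => (h2 t (interior_subset ht)).differentiableAt.differentiableWithinAt)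
      (C := 2 * M * ‖w‖ ^ 2)
      (fun t ht => by
        rw [(h2 t (interior_subset ht)).deriv]
        exact hM _ (hmem t (interior_subset ht)) w) 0 (by simp) t ht ht.1
    simpa using this
  have h4 : ∀ t ∈ Icc (0 : ℝ) 1, HasDerivAt
      (fun t : ℝ => h (y + t • w) - fderiv ℝ h y w * t - M * ‖w‖ ^ 2 * t ^ 2)
      (fderiv ℝ h (y + t • w) w - fderiv ℝ h y w - 2 * M * ‖w‖ ^ 2 * t) t := fun t ht => by
    have ha := (h1 t ht).sub ((hasDerivAt_id t).const_mul (fderiv ℝ h y w))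
    have hb := ((hasDerivAt_id t).pow 2).const_mul (M * ‖w‖ ^ 2)
    refine (ha.sub hb).congr_deriv ?_
    simp
    ring
  have h5 := (convex_Icc (0 : ℝ) 1).image_sub_le_mul_sub_of_deriv_le
    (fun t ht => (h4 t ht).continuousAt.continuousWithinAt)
    (fun t ht => (h4 t (interior_subset ht)).differentiableAt.differentiableWithinAt)
    (C := 0)
    (fun t ht => by
      rw [(h4 t (interior_subset ht)).deriv]
      linarith [h3 t (interior_subset ht)]) 0 (by simp) 1 (by simp) zero_le_one
  simp only [one_smul, zero_smul, add_zero, hw, add_sub_cancel] at h5 ⊢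
  linarith

/-- The ball of radius `r` that touches a hyperplane with normal `N`, `‖N‖ ≥ 1`, lies above any
paraboloid of opening `M ≤ 1 / (2 r)` with the same tangent hyperplane. -/
lemma mul_norm_sq_le_inner_of_mem_closedBall {F : Type*} [NormedAddCommGroup F]
    [InnerProductSpace ℝ F] {N q z : F} {r M : ℝ} (hr : 0 < r) (hN : 1 ≤ ‖N‖)
    (hM : 2 * M * r ≤ 1) (hz : z ∈ Metric.closedBall (q + r • (‖N‖⁻¹ • N)) r) :
    M * ‖z - q‖ ^ 2 ≤ inner ℝ N (z - q) := by
  have hN0 : 0 < ‖N‖ := by linarith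
  set x := inner ℝ N (z - q) with hx
  have h1 : ‖z - q‖ ^ 2 ≤ 2 * r * (‖N‖⁻¹ * x) := by
    rw [mem_closedBall_iff_norm, sub_add_eq_sub_sub] at hz
    have h2 := pow_le_pow_left₀ (norm_nonneg _) hz 2
    rw [norm_sub_sq_real, norm_smul, norm_smul, norm_inv, norm_norm, inv_mul_cancel₀ hN0.ne',
      mul_one, real_inner_smul_right, real_inner_smul_right, real_inner_comm, Real.norm_eq_abs,
      sq_abs] at h2
    linarith
  have hx0 : 0 ≤ x := by
    have h3 : 0 ≤ 2 * r * (‖N‖⁻¹ * x) := (sq_nonneg _).trans h1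
    have h4 : 0 ≤ ‖N‖⁻¹ * x := nonneg_of_mul_nonneg_right h3 (by positivity)
    exact nonneg_of_mul_nonneg_right h4 (by positivity)
  have h5 : ‖N‖⁻¹ * x ≤ x := mul_le_of_le_one_left hx0 (inv_le_one_of_one_le₀ hN)
  have h6 : ‖z - q‖ ^ 2 ≤ 2 * r * x := h1.trans (by gcongr)
  rcases le_or_gt M 0 with h | h
  · exact (mul_nonpos_of_nonpos_of_nonneg h (sq_nonneg _)).trans hx0
  · calc M * ‖z - q‖ ^ 2 ≤ M * (2 * r * x) := by gcongr
      _ = 2 * M * r * x := by ring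
      _ ≤ x := mul_le_of_le_one_left hx0 hM

/-- Near a boundary point at which `K` is locally the region above the graph of a twice
differentiable function with bounded curvature, balls of a fixed radius roll inside `K`. -/
lemma exists_rolling_ball_near (hK : IsClosed K) {κ : ℝ} {p : EuclideanSpace ℝ (Fin d)}
    (hp : p ∈ frontier K) {u : EuclideanSpace ℝ (Fin d)} {U : Set (EuclideanSpace ℝ (Fin d))}
    {h : (ℝ ∙ u)ᗮ → ℝ} (hu : ‖u‖ = 1) (hU : IsOpen U) (hpU : p ∈ U)
    (hdiff : ∀ q ∈ U, DifferentiableAt ℝ h ((ℝ ∙ u)ᗮ.orthogonalProjectionOnto q) ∧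
        DifferentiableAt ℝ (fderiv ℝ h) ((ℝ ∙ u)ᗮ.orthogonalProjectionOnto q))
    (hmem : ∀ q ∈ U, q ∈ K ↔ h ((ℝ ∙ u)ᗮ.orthogonalProjectionOnto q) ≤ inner ℝ u q)
    (hcurv : ∀ q ∈ U ∩ frontier K, ∀ y : (ℝ ∙ u)ᗮ, y = (ℝ ∙ u)ᗮ.orthogonalProjectionOnto q →
        ∀ w : (ℝ ∙ u)ᗮ, fderiv ℝ (fderiv ℝ h) y w w / √(1 + ‖fderiv ℝ h y‖ ^ 2)
              ≤ κ * (‖w‖ ^ 2 + fderiv ℝ h y w ^ 2)) :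
    ∃ r > 0, ∃ W ∈ 𝓝 p, ∀ q ∈ frontier K ∩ W, ∃ ν : EuclideanSpace ℝ (Fin d), ‖ν‖ = 1 ∧
      Metric.closedBall (q + r • ν) r ⊆ K := by
  set π := (ℝ ∙ u)ᗮ.orthogonalProjectionOnto with hπ
  have huu : inner ℝ u u = (1 : ℝ) := by rw [real_inner_self_eq_norm_sq, hu, one_pow]
  have hπu : π u = 0 := Submodule.orthogonalProjectionOnto_orthogonalComplement_singleton_eq_zero u
  have hπc : ∀ y : (ℝ ∙ u)ᗮ, π (y : EuclideanSpace ℝ (Fin d)) = y := fun y =>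
    Submodule.orthogonalProjectionOnto_mem_subspace_eq_self y
  have huy : ∀ y : (ℝ ∙ u)ᗮ, inner ℝ u (y : EuclideanSpace ℝ (Fin d)) = (0 : ℝ) := fun y =>
    Submodule.mem_orthogonal_singleton_iff_inner_right.1 y.2
  have hdecomp : ∀ q : EuclideanSpace ℝ (Fin d),
      ((π q : (ℝ ∙ u)ᗮ) : EuclideanSpace ℝ (Fin d)) + (inner ℝ u q : ℝ) • u = q := fun q => by
    rw [hπ, Submodule.orthogonalProjectionOnto_orthogonal]
    simp [Submodule.starProjection_unit_singleton ℝ hu]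
  have hπle : ∀ z : EuclideanSpace ℝ (Fin d), ‖π z‖ ≤ ‖z‖ :=
    Submodule.norm_orthogonalProjectionOnto_apply_le _
  -- Boundary points in the chart lie on the graph.
  have hgraph : ∀ q ∈ U, q ∈ frontier K → inner ℝ u q = h (π q) := by
    intro q hqU hq
    refine le_antisymm ?_ ((hmem q hqU).1 (hK.frontier_subset hq))
    by_contra! hlt
    have hcont : ContinuousAt (fun z => h (π z)) q :=
      ContinuousAt.comp (f := fun z => π z) (hdiff q hqU).1.continuousAt π.continuous.continuousAt
    have hcont2 : ContinuousAt (fun z : EuclideanSpace ℝ (Fin d) => (inner ℝ u z : ℝ)) q :=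
      (Continuous.inner continuous_const continuous_id).continuousAt
    refine hq.2 (mem_interior_iff_mem_nhds.2 ?_)
    filter_upwards [hcont.eventually_lt hcont2 hlt, hU.mem_nhds hqU] with z hz hzU
    exact (hmem z hzU).2 hz.le
  let G : (ℝ ∙ u)ᗮ → EuclideanSpace ℝ (Fin d) := fun y => (y : EuclideanSpace ℝ (Fin d)) + h y • u
  have hπG : ∀ y, π (G y) = y := fun y => by
    simp only [G, map_add, map_smul, hπu, hπc, smul_zero, add_zero]
  have huG : ∀ y, inner ℝ u (G y) = h y := fun y => by
    simp only [G, inner_add_right, real_inner_smul_right, huy, huu, mul_one, zero_add]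
  -- Graph points in the chart are boundary points.
  have hGfr : ∀ y, G y ∈ U → G y ∈ frontier K := by
    intro y hy
    rw [hK.frontier_eq]
    refine ⟨(hmem _ hy).2 (by rw [hπG, huG]), fun hint => ?_⟩
    have hcont : ContinuousAt (fun t : ℝ => G y - t • u) 0 := by fun_prop
    have hev : ∀ᶠ t in 𝓝[>] (0 : ℝ), G y - t • u ∈ U ∩ interior K := by
      refine (hcont.eventually_mem ?_).filter_mono nhdsWithin_le_nhds
      simp only [zero_smul, sub_zero]
      exact (hU.inter isOpen_interior).mem_nhds ⟨hy, hint⟩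
    obtain ⟨t, ⟨htU, htK⟩, ht⟩ := (hev.and self_mem_nhdsWithin).exists
    have h1 := (hmem _ htU).1 (interior_subset htK)
    rw [map_sub, map_smul, hπG, hπu, smul_zero, sub_zero, inner_sub_right, huG,
      real_inner_smul_right, huu, mul_one] at h1
    have h2 : (0 : ℝ) < t := ht
    linarith
  set y₀ := π p with hy₀
  have hGy₀ : G y₀ = p := by
    simp only [G, hy₀, ← hgraph p hpU hp, hdecomp]
  obtain ⟨hd1, hd2⟩ := hdiff p hpU
  set b := ‖fderiv ℝ h y₀‖ + 1 with hb
  have hb0 : 0 < b := by positivity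
  have hev : ∀ᶠ y in 𝓝 y₀, G y ∈ U ∧ ‖fderiv ℝ h y‖ < b := by
    refine Filter.Eventually.and ?_ ?_
    · have hcont : ContinuousAt G y₀ :=
        (continuous_subtype_val.continuousAt).add (hd1.continuousAt.smul continuousAt_const)
      exact hcont.eventually_mem (by rw [hGy₀]; exact hU.mem_nhds hpU)
    · have hcont : ContinuousAt (fun y => ‖fderiv ℝ h y‖) y₀ :=
        (continuous_norm (E := (ℝ ∙ u)ᗮ →L[ℝ] ℝ)).continuousAt.tendsto.comp hd2.continuousAt
      exact hcont.eventually_lt continuousAt_const (by linarith)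
  obtain ⟨η, hη, hηball⟩ := Metric.eventually_nhds_iff_ball.1 hev
  obtain ⟨δ₀, hδ₀, hδU⟩ := Metric.isOpen_iff.1 hU p hpU
  set δ := min δ₀ η with hδ
  have hδ0 : 0 < δ := lt_min hδ₀ hη
  set M : ℝ := (|κ| + 1) * ((1 + b ^ 2) * √(1 + b ^ 2)) / 2 with hM
  have hM0 : 0 < M := by positivity
  have hsecond : ∀ y ∈ Metric.ball y₀ η, ∀ w, fderiv ℝ (fderiv ℝ h) y w w ≤ 2 * M * ‖w‖ ^ 2 := by
    intro y hy w
    obtain ⟨hyU, hyb⟩ := hηball y hy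
    have h1 := hcurv (G y) ⟨hyU, hGfr y hyU⟩ y (hπG y).symm w
    rw [div_le_iff₀ (by positivity)] at h1
    have h2 : fderiv ℝ h y w ^ 2 ≤ b ^ 2 * ‖w‖ ^ 2 := by
      rw [← sq_abs, ← mul_pow]
      refine pow_le_pow_left₀ (abs_nonneg _) ?_ 2
      exact ((fderiv ℝ h y).le_opNorm w).trans (by gcongr)
    calc fderiv ℝ (fderiv ℝ h) y w w
        ≤ κ * (‖w‖ ^ 2 + fderiv ℝ h y w ^ 2) * √(1 + ‖fderiv ℝ h y‖ ^ 2) := h1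
      _ ≤ (|κ| + 1) * (‖w‖ ^ 2 + b ^ 2 * ‖w‖ ^ 2) * √(1 + b ^ 2) := by
          gcongr
          linarith [le_abs_self κ]
      _ = 2 * M * ‖w‖ ^ 2 := by rw [hM]; ring
  set r := min (1 / (2 * M)) (δ / 8) with hr
  have hr0 : 0 < r := lt_min (by positivity) (by positivity)
  have hrM : 2 * M * r ≤ 1 := by
    calc 2 * M * r ≤ 2 * M * (1 / (2 * M)) := by gcongr; exact min_le_left _ _
      _ = 1 := by field_simp
  refine ⟨r, hr0, Metric.ball p (δ / 2), Metric.ball_mem_nhds p (by positivity), ?_⟩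
  rintro q ⟨hq, hqp⟩
  have hqU : q ∈ U := hδU (Metric.ball_subset_ball (by linarith [min_le_left δ₀ η]) hqp)
  have hchart : ∀ z, dist z p < δ → z ∈ U ∧ π z ∈ Metric.ball y₀ η := by
    intro z hz
    refine ⟨hδU (Metric.mem_ball.2 (hz.trans_le (min_le_left _ _))), ?_⟩
    rw [mem_ball_iff_norm, hy₀, ← map_sub]
    refine (hπle _).trans_lt ?_
    rw [← dist_eq_norm]
    exact hz.trans_le (min_le_right _ _)
  set g : (ℝ ∙ u)ᗮ := (InnerProductSpace.toDual ℝ (ℝ ∙ u)ᗮ).symm (fderiv ℝ h (π q)) with hg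
  -- An inner normal to the graph at `q`.
  set N : EuclideanSpace ℝ (Fin d) := u - g with hN
  have hinner : ∀ z : EuclideanSpace ℝ (Fin d),
      inner ℝ N z = inner ℝ u z - fderiv ℝ h (π q) (π z) := by
    intro z
    rw [hN, inner_sub_left, ← Submodule.inner_orthogonalProjectionOnto_eq_of_mem_left g z, hg,
      InnerProductSpace.toDual_symm_apply]
  have hN1 : 1 ≤ ‖N‖ := by
    have h1 := real_inner_le_norm N u
    rw [hinner, hπu, map_zero, sub_zero, huu, hu, mul_one] at h1
    exact h1
  refine ⟨‖N‖⁻¹ • N, ?_, fun z hz => ?_⟩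
  · rw [norm_smul, norm_inv, norm_norm, inv_mul_cancel₀ (by linarith)]
  have hzq : dist z q ≤ 2 * r := by
    have h1 : dist (q + r • (‖N‖⁻¹ • N)) q ≤ r := by
      rw [dist_eq_norm, add_sub_cancel_left, norm_smul, norm_smul, norm_inv, norm_norm,
        inv_mul_cancel₀ (by linarith), mul_one, Real.norm_of_nonneg hr0.le]
    linarith [dist_triangle z (q + r • (‖N‖⁻¹ • N)) q, Metric.mem_closedBall.1 hz]
  have hrδ : r ≤ δ / 8 := min_le_right _ _
  have hqp' : dist q p < δ / 2 := hqp
  obtain ⟨hzU, hzb⟩ := hchart z (by linarith [dist_triangle z q p])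
  obtain ⟨-, hqb⟩ := hchart q (by linarith)
  rw [hmem z hzU]
  have htaylor := le_taylor_of_fderiv_fderiv_le (convex_ball y₀ η)
    (fun y hy => by have := hdiff (G y) (hηball y hy).1; rwa [hπG] at this) hsecond hqb hzb
  have hball := mul_norm_sq_le_inner_of_mem_closedBall hr0 hN1 hrM hz
  rw [hinner, inner_sub_right, hgraph q hqU hq, map_sub] at hball
  have hproj : ‖π z - π q‖ ^ 2 ≤ ‖z - q‖ ^ 2 := by
    rw [← map_sub]
    exact pow_le_pow_left₀ (norm_nonneg _) (hπle _) 2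
  have := mul_le_mul_of_nonneg_left hproj hM0.le
  linarith

lemma closedBall_add_smul_subset {F : Type*} [NormedAddCommGroup F] [NormedSpace ℝ F] {q ν : F}
    (hν : ‖ν‖ = 1) {r s : ℝ} (hrs : r ≤ s) :
    Metric.closedBall (q + r • ν) r ⊆ Metric.closedBall (q + s • ν) s := by
  refine Metric.closedBall_subset_closedBall' ?_
  rw [dist_eq_norm, add_sub_add_left_eq_sub, ← sub_smul, norm_smul, hν, mul_one, Real.norm_eq_abs,
    abs_sub_comm, abs_of_nonneg (by linarith)]
  linarith

/-- A ball of fixed radius rolls freely inside a smooth body. -/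
lemma exists_rolling_ball (hK : IsCompact K) (hsmooth : IsSmoothBody K) :
    ∃ r > 0, ∀ q ∈ frontier K, ∃ ν : EuclideanSpace ℝ (Fin d), ‖ν‖ = 1 ∧
      Metric.closedBall (q + r • ν) r ⊆ K := by
  obtain ⟨κ₁, κ₂, -, hloc⟩ := hsmooth
  have hcomp : IsCompact (frontier K) :=
    hK.of_isClosed_subset isClosed_frontier hK.isClosed.frontier_subset
  have key : ∃ r > 0, ∀ q ∈ frontier K ∩ frontier K, ∃ ν : EuclideanSpace ℝ (Fin d), ‖ν‖ = 1 ∧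
      Metric.closedBall (q + r • ν) r ⊆ K := by
    refine hcomp.induction_on (p := fun S => ∃ r > 0, ∀ q ∈ frontier K ∩ S,
      ∃ ν : EuclideanSpace ℝ (Fin d), ‖ν‖ = 1 ∧ Metric.closedBall (q + r • ν) r ⊆ K) ?_ ?_ ?_ ?_
    · exact ⟨1, one_pos, by simp⟩
    · rintro s t hst ⟨r, hr, h⟩
      exact ⟨r, hr, fun q hq => h q ⟨hq.1, hst hq.2⟩⟩
    · rintro s t ⟨r₁, hr₁, h₁⟩ ⟨r₂, hr₂, h₂⟩
      refine ⟨min r₁ r₂, lt_min hr₁ hr₂, ?_⟩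
      rintro q ⟨hq, hqs | hqt⟩
      · obtain ⟨ν, hν, hsub⟩ := h₁ q ⟨hq, hqs⟩
        exact ⟨ν, hν, (closedBall_add_smul_subset hν (min_le_left _ _)).trans hsub⟩
      · obtain ⟨ν, hν, hsub⟩ := h₂ q ⟨hq, hqt⟩
        exact ⟨ν, hν, (closedBall_add_smul_subset hν (min_le_right _ _)).trans hsub⟩
    · intro p hp
      obtain ⟨u, U, h, hu, hU, hpU, hdiff, hmem, hcurv⟩ := hloc p hp
      obtain ⟨r, hr, W, hW, hball⟩ := exists_rolling_ball_near hK.isClosed hp hu hU hpU hdiff hmem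
        fun q hq y hy w => (hcurv q hq y hy w).2
      exact ⟨W, mem_nhdsWithin_of_mem_nhds hW, r, hr, hball⟩
  obtain ⟨r, hr, h⟩ := key
  exact ⟨r, hr, fun q hq => h q ⟨hq, hq⟩⟩

lemma exists_add_smul_mem_frontier (hK : IsCompact K) {z e : EuclideanSpace ℝ (Fin d)} (hz : z ∈ K)
    (he : ‖e‖ = 1) : ∃ t : ℝ, 0 ≤ t ∧ z + t • e ∈ frontier K := by
  let T : Set ℝ := {t | 0 ≤ t ∧ z + t • e ∈ K}
  obtain ⟨R, hR⟩ := hK.isBounded.subset_closedBall z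
  have hT : IsCompact T := by
    refine (isCompact_Icc (a := (0 : ℝ)) (b := R)).of_isClosed_subset ?_ fun t ht => ⟨ht.1, ?_⟩
    · exact (isClosed_le continuous_const continuous_id).inter (hK.isClosed.preimage (by fun_prop))
    · have h1 := hR ht.2
      rwa [mem_closedBall_iff_norm, add_sub_cancel_left, norm_smul, he, mul_one,
        Real.norm_of_nonneg ht.1] at h1
  obtain ⟨t, ht, hmax⟩ := hT.exists_isGreatest ⟨0, le_rfl, by simpa using hz⟩
  refine ⟨t, ht.1, ?_⟩
  rw [hK.isClosed.frontier_eq]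
  refine ⟨ht.2, fun hint => ?_⟩
  have hcont : ContinuousAt (fun s : ℝ => z + s • e) t := by fun_prop
  have hev : ∀ᶠ s in 𝓝[>] t, z + s • e ∈ K :=
    (hcont.eventually_mem (mem_interior_iff_mem_nhds.1 hint)).filter_mono nhdsWithin_le_nhds
  obtain ⟨s, hs, hts⟩ := (hev.and self_mem_nhdsWithin).exists
  have hts' : t < s := hts
  exact absurd (hmax ⟨ht.1.trans hts'.le, hs⟩) (not_le.2 hts')

lemma convex_combination_closedBall_subset (hconv : Convex ℝ K) {c₁ c₂ : EuclideanSpace ℝ (Fin d)}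
    {r a b : ℝ} (h₁ : Metric.closedBall c₁ r ⊆ K) (h₂ : Metric.closedBall c₂ r ⊆ K)
    (ha : 0 ≤ a) (hb : 0 ≤ b) (hab : a + b = 1) :
    Metric.closedBall (a • c₁ + b • c₂) r ⊆ K := by
  intro z hz
  rw [mem_closedBall_iff_norm] at hz
  set e := z - (a • c₁ + b • c₂) with he
  have hz2 : z = a • (c₁ + e) + b • (c₂ + e) := by
    have : z = (a • c₁ + b • c₂) + (a + b) • e := by rw [hab, one_smul, he]; abel
    rw [this, add_smul, smul_add, smul_add]
    abel
  rw [hz2]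
  exact hconv (h₁ (by simpa using hz)) (h₂ (by simpa using hz)) ha hb hab

/-- A convex body in which a ball of radius `r` rolls freely is a union of balls of radius `r`: the
centres of such balls form a convex set. -/
lemma exists_mem_closedBall_subset (hd : 0 < d) (hK : IsCompact K) (hconv : Convex ℝ K) {r : ℝ}
    (hr : 0 < r) (hroll : ∀ q ∈ frontier K, ∃ ν : EuclideanSpace ℝ (Fin d), ‖ν‖ = 1 ∧
      Metric.closedBall (q + r • ν) r ⊆ K) {z : EuclideanSpace ℝ (Fin d)} (hz : z ∈ K) :
    ∃ c, dist z c ≤ r ∧ Metric.closedBall c r ⊆ K := by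
  have hO : Convex ℝ {z | ∃ c, dist z c ≤ r ∧ Metric.closedBall c r ⊆ K} := by
    rintro x ⟨c, hxc, hc⟩ y ⟨c', hyc, hc'⟩ a b ha hb hab
    refine ⟨a • c + b • c', ?_, convex_combination_closedBall_subset hconv hc hc' ha hb hab⟩
    rw [dist_eq_norm] at hxc hyc ⊢
    calc ‖a • x + b • y - (a • c + b • c')‖ = ‖a • (x - c) + b • (y - c')‖ := by
          congr 1; simp only [smul_sub]; abel
      _ ≤ a * ‖x - c‖ + b * ‖y - c'‖ := by
          refine (norm_add_le _ _).trans (le_of_eq ?_)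
          rw [norm_smul, norm_smul, Real.norm_of_nonneg ha, Real.norm_of_nonneg hb]
      _ ≤ a * r + b * r := by gcongr
      _ = r := by rw [← add_mul, hab, one_mul]
  have hfr : frontier K ⊆ {z | ∃ c, dist z c ≤ r ∧ Metric.closedBall c r ⊆ K} := by
    intro q hq
    obtain ⟨ν, hν, hball⟩ := hroll q hq
    refine ⟨q + r • ν, ?_, hball⟩
    rw [dist_self_add_right, norm_smul, hν, mul_one, Real.norm_of_nonneg hr.le]
  set e : EuclideanSpace ℝ (Fin d) := EuclideanSpace.single ⟨0, hd⟩ 1 with he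
  have he1 : ‖e‖ = 1 := by simp [he]
  obtain ⟨s, hs, hsf⟩ := exists_add_smul_mem_frontier hK hz he1
  obtain ⟨t, ht, htf⟩ := exists_add_smul_mem_frontier hK hz (e := -e) (by rwa [norm_neg])
  refine hO.segment_subset (hfr htf) (hfr hsf) ?_
  rcases hs.eq_or_lt with h | h
  · rw [← h, zero_smul, add_zero]
    exact right_mem_segment ℝ _ _
  refine ⟨s / (s + t), t / (s + t), by positivity, by positivity, by field_simp, ?_⟩
  simp only [smul_add, smul_neg, smul_smul, add_add_add_comm, ← add_smul, ← neg_smul]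
  have h1 : s / (s + t) + t / (s + t) = 1 := by field_simp
  have h2 : s / (s + t) * -t + t / (s + t) * s = 0 := by field_simp; ring
  rw [h1, h2, one_smul, zero_smul, add_zero]

/-- A cap of height `t` of a ball of radius `R` contains a box of height `t / 2` and of width of
order `√(R t)` in the other directions. -/
lemma isDeep_of_closedBall_subset (hd : 0 < d) (hK : IsCompact K) {c y : EuclideanSpace ℝ (Fin d)}
    {R t : ℝ} (hball : Metric.closedBall c R ⊆ K) (ht : 0 < t) (htR : t ≤ R)
    (hy : dist y c ≤ R - t) :
    IsDeep K (t / 2 * (2 * √(R * t / (2 * d))) ^ (d - 1)) y := by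
  intro a ha
  have hd0 : (0 : ℝ) < d := by exact_mod_cast hd
  have hR0 : 0 < R := ht.trans_le htR
  set γ := √(R * t / (2 * d)) with hγ
  have hγ2 : γ ^ 2 = R * t / (2 * d) := Real.sq_sqrt (by positivity)
  have hγ0 : 0 ≤ γ := Real.sqrt_nonneg _
  have ha0 : 0 < ‖a‖ := norm_pos_iff.2 ha
  set a' := ‖a‖⁻¹ • a with ha'
  have ha'1 : ‖a'‖ = 1 := by rw [ha', norm_smul, norm_inv, norm_norm, inv_mul_cancel₀ ha0.ne']
  set i₀ : Fin d := ⟨0, hd⟩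
  obtain ⟨b, hb⟩ := Orthonormal.exists_orthonormalBasis_extension_of_card_eq (𝕜 := ℝ)
    (E := EuclideanSpace ℝ (Fin d)) (ι := Fin d) (by simp) (v := fun _ => a') (s := {i₀})
    ⟨fun i => ha'1, fun i j hij => absurd (Subsingleton.elim i j) hij⟩
  have hb0 : b i₀ = a' := hb i₀ rfl
  let l : Fin d → ℝ := fun i => if i = i₀ then R - t else -γ
  let u : Fin d → ℝ := fun i => if i = i₀ then R - t / 2 else γ
  let B : Set (EuclideanSpace ℝ (Fin d)) := b.repr ⁻¹' {v | ∀ i, v i ∈ Icc (l i) (u i)}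
  have hBm : MeasurableSet {v : EuclideanSpace ℝ (Fin d) | ∀ i, v i ∈ Icc (l i) (u i)} := by
    have h1 : {v : EuclideanSpace ℝ (Fin d) | ∀ i, v i ∈ Icc (l i) (u i)} =
        WithLp.ofLp ⁻¹' univ.pi fun i => Icc (l i) (u i) := by
      ext v
      exact ⟨fun h i _ => h i, fun h i => h i trivial⟩
    rw [h1]
    exact (MeasurableSet.univ_pi fun i => measurableSet_Icc).preimage
      (PiLp.volume_preserving_ofLp (Fin d)).measurable
  have hvB : volume B = ENNReal.ofReal (t / 2 * (2 * γ) ^ (d - 1)) := by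
    rw [b.measurePreserving_repr.measure_preimage hBm.nullMeasurableSet, volume_box,
      ← Finset.mul_prod_erase _ _ (Finset.mem_univ i₀)]
    have h1 : ∀ i ∈ Finset.univ.erase i₀,
        ENNReal.ofReal (u i - l i) = ENNReal.ofReal (2 * γ) := by
      intro i hi
      simp only [u, l, if_neg (Finset.ne_of_mem_erase hi)]
      congr 1
      ring
    have h2 : u i₀ - l i₀ = t / 2 := by
      simp only [u, l, if_true]
      ring
    rw [Finset.prod_congr rfl h1, Finset.prod_const, Finset.card_erase_of_mem (Finset.mem_univ _),
      Finset.card_univ, Fintype.card_fin, h2, ← ENNReal.ofReal_pow (by positivity),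
      ← ENNReal.ofReal_mul (by positivity)]
  have hsub : (fun w => c + w) '' B ⊆ K ∩ {z | inner ℝ a y ≤ inner ℝ a z} := by
    rintro _ ⟨w, hw, rfl⟩
    have h0 := hw i₀
    simp only [l, u, if_true, b.repr_apply_apply, hb0] at h0
    refine ⟨hball ?_, ?_⟩
    · rw [mem_closedBall_iff_norm, add_sub_cancel_left]
      refine abs_le_of_sq_le_sq' ?_ (by linarith) |>.2
      have h1 : ‖w‖ ^ 2 = ∑ i, (b.repr w i) ^ 2 := by
        rw [← b.repr.norm_map w, EuclideanSpace.norm_sq_eq]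
        simp
      rw [h1, ← Finset.add_sum_erase _ _ (Finset.mem_univ i₀)]
      have h2 : (b.repr w i₀) ^ 2 ≤ (R - t / 2) ^ 2 := by
        rw [b.repr_apply_apply, hb0]
        exact pow_le_pow_left₀ (by linarith [h0.1]) h0.2 2
      have h3 : ∑ i ∈ Finset.univ.erase i₀, (b.repr w i) ^ 2 ≤ d * γ ^ 2 := by
        calc ∑ i ∈ Finset.univ.erase i₀, (b.repr w i) ^ 2
            ≤ ∑ _i ∈ Finset.univ.erase i₀, γ ^ 2 := by
              refine Finset.sum_le_sum fun i hi => ?_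
              have := hw i
              simp only [l, u, if_neg (Finset.ne_of_mem_erase hi)] at this
              exact sq_le_sq' this.1 this.2
          _ ≤ d * γ ^ 2 := by
              rw [Finset.sum_const, nsmul_eq_mul]
              gcongr
              exact (Finset.card_le_univ _).trans_eq (Fintype.card_fin d)
      have h4 : d * γ ^ 2 = R * t / 2 := by rw [hγ2]; field_simp
      nlinarith
    · have h1 : inner ℝ a' (y - c) ≤ R - t := by
        refine (real_inner_le_norm _ _).trans ?_
        rw [ha'1, one_mul, ← dist_eq_norm]
        exact hy
      have h2 : inner ℝ a' (y - c) ≤ inner ℝ a' w := h1.trans h0.1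
      rw [ha', real_inner_smul_left, real_inner_smul_left,
        mul_le_mul_iff_right₀ (inv_pos.2 ha0), inner_sub_right] at h2
      simp only [mem_ofPred_eq, inner_add_right]
      linarith
  have hfin : volume (K ∩ {z | inner ℝ a y ≤ inner ℝ a z}) ≠ ∞ :=
    ((measure_mono inter_subset_left).trans_lt hK.measure_lt_top).ne
  have h2 := (measure_mono hsub : volume _ ≤ volume _)
  rw [image_add_left, measure_preimage_add, hvB] at h2
  rw [measureReal_def, ← ENNReal.toReal_ofReal (r := t / 2 * (2 * γ) ^ (d - 1)) (by positivity)]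
  exact ENNReal.toReal_mono hfin h2

/-- In a smooth body the points of depth less than `ε` have volume `O(ε ^ (2 / (d + 1)))`: the copy
of `K` shrunk by the factor `1 - s` consists of points at height `r s` in a ball of radius `r`
inside `K`, whose depth is of the order `s ^ ((d + 1) / 2)`. -/
lemma exists_volume_not_isDeep_le_of_isSmoothBody (hd : 0 < d) (hK : IsCompact K)
    (hconv : Convex ℝ K) (hvol : volume K = 1) (hsmooth : IsSmoothBody K) :
    ∃ C : ℝ, 0 ≤ C ∧ ∀ ε : ℝ, 0 < ε →
      volume {y ∈ K | ¬ IsDeep K ε y} ≤ ENNReal.ofReal (C * ε ^ ((2 : ℝ) / (d + 1))) := by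
  obtain ⟨r, hr, hroll⟩ := exists_rolling_ball hK hsmooth
  have hd1 : (1 : ℝ) ≤ d := by exact_mod_cast hd
  have hne : K.Nonempty := by
    rw [nonempty_iff_ne_empty]
    rintro rfl
    simp at hvol
  obtain ⟨z₀, hz₀⟩ := hne
  obtain ⟨o, -, ho⟩ := exists_mem_closedBall_subset hd hK hconv hr hroll hz₀
  set κ : ℝ := r / 2 * (2 * √(r * r / (2 * d))) ^ (d - 1) with hκ
  have hκ0 : 0 < κ := by positivity
  refine ⟨d * (κ⁻¹ ^ ((2 : ℝ) / (d + 1))), by positivity, fun ε hε => ?_⟩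
  set σ : ℝ := (ε / κ) ^ ((d + 1 : ℝ)⁻¹) with hσ
  have hσ0 : 0 < σ := by positivity
  have hσpow : κ * σ ^ (d + 1) = ε := by
    rw [hσ, ← Real.rpow_natCast, ← Real.rpow_mul (by positivity)]
    push_cast
    rw [inv_mul_cancel₀ (by positivity), Real.rpow_one]
    field_simp
  have hσ2 : d * σ ^ 2 = d * (κ⁻¹ ^ ((2 : ℝ) / (d + 1))) * ε ^ ((2 : ℝ) / (d + 1)) := by
    have hexp : (d + 1 : ℝ)⁻¹ * (2 : ℕ) = 2 / (d + 1) := by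
      rw [inv_mul_eq_div]
      norm_num
    rw [mul_assoc, ← Real.mul_rpow (by positivity) hε.le, hσ, ← Real.rpow_natCast,
      ← Real.rpow_mul (by positivity), hexp, inv_mul_eq_div]
  rw [← hσ2]
  have hle1 : volume {y ∈ K | ¬ IsDeep K ε y} ≤ 1 := hvol ▸ measure_mono fun y hy => hy.1
  rcases le_or_gt 1 σ with h1 | h1
  · refine hle1.trans ?_
    rw [ENNReal.one_le_ofReal]
    nlinarith [one_le_pow₀ h1 (n := 2)]
  set s := σ ^ 2 with hs
  have hs0 : 0 < s := by positivity
  have hs1 : s < 1 := pow_lt_one₀ hσ0.le h1 two_ne_zero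
  set I := AffineMap.homothety o (1 - s) '' K with hI
  have hIK : I ⊆ K := by
    rintro _ ⟨z, hz, rfl⟩
    rw [AffineMap.homothety_eq_lineMap]
    exact hconv.lineMap_mem (ho (Metric.mem_closedBall_self hr.le)) hz ⟨by linarith, by linarith⟩
  have hIvol : volume I = ENNReal.ofReal ((1 - s) ^ d) := by
    rw [hI, Measure.addHaar_image_homothety, hvol, mul_one, finrank_euclideanSpace_fin,
      abs_of_nonneg (pow_nonneg (by linarith) d)]
  have hIm : MeasurableSet I := (hK.image (AffineMap.homothety_continuous o (1 - s))).measurableSet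
  have hdeep : ∀ y ∈ I, IsDeep K ε y := by
    rintro _ ⟨z, hz, rfl⟩
    obtain ⟨c, hzc, hc⟩ := exists_mem_closedBall_subset hd hK hconv hr hroll hz
    have hball := convex_combination_closedBall_subset hconv hc ho (a := 1 - s) (b := s)
      (by linarith) hs0.le (by ring)
    have hdist : dist (AffineMap.homothety o (1 - s) z) ((1 - s) • c + s • o) ≤ r - r * s := by
      rw [AffineMap.homothety_apply, dist_eq_norm]
      have h2 : ((1 - s) • (z -ᵥ o) +ᵥ o) - ((1 - s) • c + s • o) = (1 - s) • (z - c) := by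
        simp only [vsub_eq_sub, vadd_eq_add, smul_sub, sub_smul, one_smul]
        abel
      rw [h2, norm_smul, Real.norm_of_nonneg (by linarith), ← dist_eq_norm]
      nlinarith
    have h3 := isDeep_of_closedBall_subset hd hK hball (t := r * s) (by positivity)
      (by nlinarith) hdist
    have h4 : r * s / 2 * (2 * √(r * (r * s) / (2 * d))) ^ (d - 1) = ε := by
      have h5 : √(r * (r * s) / (2 * d)) = √(r * r / (2 * d)) * σ := by
        rw [show r * (r * s) / (2 * d) = r * r / (2 * d) * σ ^ 2 by rw [hs]; ring,
          Real.sqrt_mul (by positivity), Real.sqrt_sq hσ0.le]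
      have h6 : σ ^ (d + 1) = σ ^ 2 * σ ^ (d - 1) := by rw [← pow_add]; congr 1; omega
      rw [h5, ← hσpow, hκ, h6, hs, ← mul_assoc 2, mul_pow _ σ]
      ring
    rwa [h4] at h3
  calc volume {y ∈ K | ¬ IsDeep K ε y} ≤ volume (K \ I) :=
        measure_mono fun y hy => ⟨hy.1, fun hyI => hy.2 (hdeep y hyI)⟩
    _ = 1 - ENNReal.ofReal ((1 - s) ^ d) := by
        rw [measure_sdiff hIK hIm.nullMeasurableSet (by rw [hIvol]; simp), hvol, hIvol]
    _ = ENNReal.ofReal (1 - (1 - s) ^ d) := by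
        rw [ENNReal.ofReal_sub _ (pow_nonneg (by linarith) d), ENNReal.ofReal_one]
    _ ≤ ENNReal.ofReal (d * s) := by
        refine ENNReal.ofReal_le_ofReal ?_
        have h2 := one_add_mul_le_pow (a := -s) (by linarith) d
        rw [← sub_eq_add_neg] at h2
        linarith

theorem increment_le_of_isSmoothBody (hd : 0 < d) (hK : IsCompact K) (hconv : Convex ℝ K)
    (hvol : volume K = 1) (hsmooth : IsSmoothBody K) :
    ∃ (C : ℝ) (A N : ℕ), ∀ n : ℕ, N ≤ n → ∀ m : ℕ,
      |expectedHullVolume K (n + m) - expectedHullVolume K n|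
        ≤ C * ((m * (n : ℝ) ^ (-(2 : ℝ) / ((d : ℝ) + 1)) + 1) * (n : ℝ)⁻¹ * Real.log n ^ A) := by
  obtain ⟨C₁, hC₁, N, hN⟩ := exists_abs_sub_le_of_volume_not_isDeep hK hconv hvol
  obtain ⟨C₂, hC₂, hdeep⟩ := exists_volume_not_isDeep_le_of_isSmoothBody hd hK hconv hvol hsmooth
  have hd1 : (1 : ℝ) ≤ d := by exact_mod_cast hd
  set ν : ℝ := 4 * (d + 1) with hν
  have hν1 : 1 ≤ ν := by linarith
  set θ : ℝ := 2 / (d + 1) with hθ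
  have hθ0 : 0 < θ := by positivity
  have hθ1 : θ ≤ 1 := by rw [hθ, div_le_one (by positivity)]; linarith
  set B : ℝ := C₂ * ν + C₁ with hB
  refine ⟨2 * (d + 1) * B, 1, max N 3, fun n hn m => ?_⟩
  have hn3 : 3 ≤ n := (le_max_right N 3).trans hn
  have hn0 : (0 : ℝ) < n := by positivity
  have hn1 : (1 : ℝ) ≤ n := by exact_mod_cast (by omega : 1 ≤ n)
  have hlog : 1 ≤ Real.log n := by
    rw [Real.le_log_iff_exp_le hn0]
    have h3 : (3 : ℝ) ≤ n := by exact_mod_cast hn3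
    linarith [Real.exp_one_lt_d9]
  set ℓ := Real.log n with hℓ
  have hℓ0 : 0 < ℓ := by linarith
  set x : ℝ := (n : ℝ) ^ (-(2 : ℝ) / ((d : ℝ) + 1)) with hx
  have hxθ : x = (n : ℝ)⁻¹ ^ θ := by
    rw [hx, Real.inv_rpow hn0.le, ← Real.rpow_neg hn0.le, hθ, neg_div]
  have hx0 : 0 < x := by positivity
  have hnx : (n : ℝ)⁻¹ ≤ x := by
    rw [hxθ]
    calc (n : ℝ)⁻¹ = (n : ℝ)⁻¹ ^ (1 : ℝ) := (Real.rpow_one _).symm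
      _ ≤ (n : ℝ)⁻¹ ^ θ := Real.rpow_le_rpow_of_exponent_ge (by positivity)
          (inv_le_one_of_one_le₀ hn1) hθ1
  have hv : C₂ * (ν * ℓ / n) ^ θ ≤ C₂ * ν * x * ℓ := by
    have h1 : (ν * ℓ) ^ θ ≤ ν * ℓ := by
      calc (ν * ℓ) ^ θ ≤ (ν * ℓ) ^ (1 : ℝ) :=
            Real.rpow_le_rpow_of_exponent_le (one_le_mul_of_one_le_of_one_le hν1 hlog) hθ1
        _ = ν * ℓ := Real.rpow_one _
    rw [div_eq_mul_inv, Real.mul_rpow (by positivity) (by positivity), ← hxθ]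
    calc C₂ * ((ν * ℓ) ^ θ * x) ≤ C₂ * (ν * ℓ * x) := by gcongr
      _ = C₂ * ν * x * ℓ := by ring
  have key := hN n ((le_max_left N 3).trans hn) _ (by positivity)
    ((hdeep (ν * ℓ / n) (by positivity)).trans (ENNReal.ofReal_le_ofReal hv)) m
  calc |expectedHullVolume K (n + m) - expectedHullVolume K n|
      ≤ m * (2 * (d + 1) * (C₂ * ν * x * ℓ + C₁ * (n : ℝ)⁻¹) / n) := key
    _ ≤ m * (2 * (d + 1) * (C₂ * ν * x * ℓ + C₁ * (x * ℓ)) / n) := by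
        gcongr m * (2 * (d + 1) * (_ + C₁ * ?_) / n)
        exact hnx.trans (le_mul_of_one_le_right hx0.le hlog)
    _ = 2 * (d + 1) * B * ((m * x + 0) * (n : ℝ)⁻¹ * ℓ ^ 1) := by
        rw [hB, div_eq_mul_inv]; ring
    _ ≤ 2 * (d + 1) * B * ((m * x + 1) * (n : ℝ)⁻¹ * ℓ ^ 1) := by
        have : 0 ≤ B := by positivity
        gcongr
        exact zero_le_one

end Smooth

/-! ### Conclusion -/

/-- In dimension `0` every non-empty random polytope is the whole space. -/
lemma expectedHullVolume_dim_zero {K : Set (EuclideanSpace ℝ (Fin 0))} (hvol : volume K = 1) {n : ℕ}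
    (hn : 0 < n) :
    expectedHullVolume K n = volume.real (Set.univ : Set (EuclideanSpace ℝ (Fin 0))) := by
  have : IsProbabilityMeasure (ProbabilityTheory.cond volume K) :=
    ProbabilityTheory.cond_isProbabilityMeasure (by simp [hvol])
  have h : ∀ x : Fin n → EuclideanSpace ℝ (Fin 0), convexHull ℝ (Set.range x) = Set.univ := by
    intro x
    refine Set.eq_univ_of_forall fun y => ?_
    rw [Subsingleton.elim y (x ⟨0, hn⟩)]
    exact subset_convexHull ℝ _ (Set.mem_range_self _)
  simp [expectedHullVolume, h]

theorem mainTheorem8 (d : ℕ) (K : ConvexBody (EuclideanSpace ℝ (Fin d)))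
    (hK : volume (K : Set (EuclideanSpace ℝ (Fin d))) = 1) :
    (∃ ν₀ C : ℝ, 0 < ν₀ ∧ ∀ ν : ℝ, ν₀ ≤ ν → ∃ N : ℕ, ∀ n : ℕ, N ≤ n → ∀ m : ℕ,
      |expectedHullVolume (K : Set (EuclideanSpace ℝ (Fin d))) (n + m)
          - expectedHullVolume (K : Set (EuclideanSpace ℝ (Fin d))) n|
        ≤ C * (maxSeenVolume (K : Set (EuclideanSpace ℝ (Fin d))) (ν * Real.log n / n)
                * m * wetVolume (K : Set (EuclideanSpace ℝ (Fin d))) (ν * Real.log n / n)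
              + maxSeenVolume (K : Set (EuclideanSpace ℝ (Fin d))) (ν * Real.log n / n)
                * Real.log n)) ∧
    (IsSmoothBody (K : Set (EuclideanSpace ℝ (Fin d))) →
      ∃ (C : ℝ) (A N : ℕ), ∀ n : ℕ, N ≤ n → ∀ m : ℕ,
        |expectedHullVolume (K : Set (EuclideanSpace ℝ (Fin d))) (n + m)
            - expectedHullVolume (K : Set (EuclideanSpace ℝ (Fin d))) n|
          ≤ C * ((m * (n : ℝ) ^ (-(2 : ℝ) / ((d : ℝ) + 1)) + 1) * (n : ℝ)⁻¹
              * Real.log n ^ A)) ∧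
    (IsConvexPolytope (K : Set (EuclideanSpace ℝ (Fin d))) →
      ∃ (C : ℝ) (A N : ℕ), ∀ n : ℕ, N ≤ n → ∀ m : ℕ,
        |expectedHullVolume (K : Set (EuclideanSpace ℝ (Fin d))) (n + m)
            - expectedHullVolume (K : Set (EuclideanSpace ℝ (Fin d))) n|
          ≤ C * ((m * (n : ℝ)⁻¹ + 1) * (n : ℝ)⁻¹ * Real.log n ^ A)) := by

  rcases Nat.eq_zero_or_pos d with rfl | hd
  · have h0 : ∀ n m : ℕ, 1 ≤ n → |expectedHullVolume (K : Set (EuclideanSpace ℝ (Fin 0))) (n + m)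
        - expectedHullVolume (K : Set (EuclideanSpace ℝ (Fin 0))) n| = 0 := fun n m hn => by
      rw [expectedHullVolume_dim_zero hK (by omega), expectedHullVolume_dim_zero hK hn, sub_self,
        abs_zero]
    refine ⟨⟨1, 0, one_pos, fun ν _ => ⟨1, fun n hn m => ?_⟩⟩,
      fun _ => ⟨0, 0, 1, fun n hn m => ?_⟩, fun _ => ⟨0, 0, 1, fun n hn m => ?_⟩⟩ <;>
    rw [h0 n m hn, zero_mul]
  · refine ⟨?_, increment_le_of_isSmoothBody hd K.isCompact K.convex hK,
      increment_le_of_isConvexPolytope K.isCompact K.convex hK⟩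
    obtain ⟨ν₀, hν₀, h⟩ := increment_le_of_floatingBody hd K.isCompact K.convex hK
    exact ⟨ν₀, 1, hν₀, by simpa only [one_mul] using h⟩
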